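/- Let $\Gamma$ be a good resolution graph of a complex normal surface singularity whose link is a rational homology sphere, i.e. a finite tree with vertex set $\mathcal V$, all vertices rational, decorated by Euler numbers, with negative definite intersection form $(\,,)$ on the lattice $L=\mathbb Z\langle E_v\rangle_{v\in\mathcal V}$. Let $L'\subset L\otimes\mathbb Q$ be the dual lattice, $\mathcal S'=\{x\in L':(x,E_v)\le 0\ \forall v\}$, $h\in L'/L$, let $s_h$ be the (coordinatewise) smallest element of $\mathcal S'$ with class $h$, let $Z_K\in L\otimes\mathbb Q$ be determined by $(Z_K,E_v)=(E_v,E_v)+2$ for all $v$, and put $\chi_h(l)=-\tfrac12(l,l-Z_K+2s_h)\in\mathbb Z$ for $l\in L$. The cube $(l,I)$ ($l\in L$, $I\subset\mathcal V$) has vertices $l+\sum_{v\in J}E_v$, $J\subset I$, and its weight is the maximum of $\chi_h$ on its vertices. Let $S_n\subset\mathbb R_{\ge0}^{\mathcal V}$ be the union of the cubes of weight $\le n$, intersected with $\mathbb R_{\ge 0}^{\mathcal V}$. Fix $s\in\mathcal S'\setminus\{0\}$, and for $d\ge0$ let $\mathfrak X_{-d}$ be the union of all cubes $(l,I)$ with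 $l\ge0$ and $(s,l)\le -d$. Let $F_{-d}H_b(S_n)$ be the image of $H_b(S_n\cap\mathfrak X_{-d},\mathbb Z)\to H_b(S_n,\mathbb Z)$, let $(E^\infty_{-d,q})_n=F_{-d}H_{-d+q}(S_n)/F_{-d-1}H_{-d+q}(S_n)$, and set $$PE_\infty(T,Q,\hbar)=\sum_{d\ge0,\,q,\,n}\operatorname{rank}(E^\infty_{-d,q})_n\;T^dQ^n\hbar^{-d+q}.$$ For $d\geq 0$ let $\min(d)=\min\{\chi_h(l): l\in L,\ l\ge0,\ (s,l)\le -d\}$. Let $e>0$ be the generator of the subgroup $\{-(s,l):l\in L\}$ of $\mathbb Z$, let $N\in\mathbb Z_{>0}$ be minimal with $\tilde s:=Ns\in L$, and define $p$ by $ep=-(s,\tilde s)$. **Theorem.** For every sufficiently large integer $k_0$, with $d_0:=e(k_0p-1)$, there exist lattice points $l_0,\dots,l_{p-1}\in L$ (depending on $k_0$) such that $$PE_\infty(T,Q,\hbar)=\frac{T^{d_0}}{1-Q}\Big[Q^{\min(d_0)}+(T^e-1)\sum_{q=0}^{p-1}T^{eq}Q^{\chi_h(l_q)}\sum_{m\ge0}T^{emp}Q^{\chi_h(l_q+m\tilde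 s)-\chi_h(l_q)}\Big]+D(T,Q,\hbar),$$ where $D$ has only finitely many nonzero terms, all of them with $T$-exponent $<d_0$. Moreover, for all $q$ and $m\ge0$, $emp=-(s,m\tilde s)$ and $$\chi_h(l_q+m\tilde s)-\chi_h(l_q)=-\tfrac12\big(m\tilde s,\;m\tilde s-Z_K+2s_h+2l_q\big).$$ Furthermore, for each $n$ only finitely many $d$ contribute a nonzero coefficient of $T^dQ^n$ to $PE_\infty(T,Q,\hbar)$, so that the substitution $T=1$ makes sense, and $PE_\infty(1,Q,\hbar)-\frac1{1-Q}$ has only finitely many nonzero terms. -/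

import Mathlib

open scoped Polynomial

/-- The intersection matrix of a graph with vertex set `V` decorated by Euler numbers:
the Euler numbers on the diagonal, `1` for each edge and `0` elsewhere. -/
noncomputable def intersectionMatrix {V : Type} [DecidableEq V] (graph : SimpleGraph V)
    (euler : V → ℤ) : Matrix V V ℤ :=
  open Classical in
  fun v w => if v = w then euler v else if graph.Adj v w then 1 else 0

/-- A (good) resolution graph of a normal surface singularity whose link is a rational homology
sphere: a tree of rational curves with a negative definite intersection form. -/
structure ResolutionGraph (V : Type) [Fintype V] [DecidableEq V] where
  graph : SimpleGraph V
  isTree : graph.IsTree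
  euler : V → ℤ
  negDef : ∀ x : V → ℚ, x ≠ 0 →
    ∑ v, ∑ w, x v * (intersectionMatrix graph euler v w : ℚ) * x w < 0

namespace ResolutionGraph

variable {V : Type} [Fintype V] [DecidableEq V] (Γ : ResolutionGraph V)

/-! ### The lattices `L ⊆ L' ⊆ L ⊗ ℚ`

`L` is `V → ℤ` and `L ⊗ ℚ` is `V → ℚ`, in the basis `E v`. The order is the coordinatewise one. -/

noncomputable def inter (v w : V) : ℤ := intersectionMatrix Γ.graph Γ.euler v w

/-- The intersection form on `L ⊗ ℚ`. -/
noncomputable def pair (x y : V → ℚ) : ℚ := ∑ v, ∑ w, x v * (Γ.inter v w : ℚ) * y w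

/-- The embedding `L → L ⊗ ℚ`. -/
def toQ : (V → ℤ) →+ (V → ℚ) where
  toFun l v := (l v : ℚ)
  map_zero' := by ext; simp
  map_add' a b := by ext; simp

/-- The basis element `E v` of `L`. -/
def E (v : V) : V → ℤ := Pi.single v 1

theorem pair_add_left (x y z : V → ℚ) : Γ.pair (x + y) z = Γ.pair x z + Γ.pair y z := by
  simp only [pair, ← Finset.sum_add_distrib, Pi.add_apply]
  refine Finset.sum_congr rfl fun v _ => Finset.sum_congr rfl fun w _ => by ring

theorem inter_comm (v w : V) : Γ.inter v w = Γ.inter w v := by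
  rcases eq_or_ne v w with rfl | h
  · rfl
  · simp only [inter, intersectionMatrix, if_neg h, if_neg h.symm]
    by_cases hvw : Γ.graph.Adj v w
    · rw [if_pos hvw, if_pos hvw.symm]
    · rw [if_neg hvw, if_neg fun hwv => hvw hwv.symm]

theorem inter_nonneg {v w : V} (h : v ≠ w) : 0 ≤ Γ.inter v w := by
  simp only [inter, intersectionMatrix, if_neg h]
  split_ifs <;> simp

theorem pair_comm (x y : V → ℚ) : Γ.pair x y = Γ.pair y x := by
  simp only [pair]
  rw [Finset.sum_comm]
  refine Finset.sum_congr rfl fun v _ => Finset.sum_congr rfl fun w _ => ?_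
  rw [Γ.inter_comm]; ring

theorem pair_smul_left (c : ℚ) (x y : V → ℚ) : Γ.pair (c • x) y = c * Γ.pair x y := by
  simp only [pair, Finset.mul_sum, Pi.smul_apply, smul_eq_mul]
  refine Finset.sum_congr rfl fun v _ => Finset.sum_congr rfl fun w _ => by ring

theorem pair_neg_left (x y : V → ℚ) : Γ.pair (-x) y = - Γ.pair x y := by
  simpa using Γ.pair_smul_left (-1) x y

theorem pair_zero_left (y : V → ℚ) : Γ.pair 0 y = 0 := by simp [pair]

theorem pair_add_right (x y z : V → ℚ) : Γ.pair x (y + z) = Γ.pair x y + Γ.pair x z := by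
  rw [pair_comm, pair_add_left, pair_comm _ y, pair_comm _ z]

theorem pair_smul_right (c : ℚ) (x y : V → ℚ) : Γ.pair x (c • y) = c * Γ.pair x y := by
  rw [pair_comm, pair_smul_left, pair_comm _ y]

theorem pair_neg_right (x y : V → ℚ) : Γ.pair x (-y) = - Γ.pair x y := by
  simpa using Γ.pair_smul_right (-1) x y

theorem pair_self_neg {x : V → ℚ} (hx : x ≠ 0) : Γ.pair x x < 0 := Γ.negDef x hx

theorem pair_self_nonpos (x : V → ℚ) : Γ.pair x x ≤ 0 := by
  rcases eq_or_ne x 0 with rfl | hx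
  · simp [pair]
  · exact (Γ.pair_self_neg hx).le

theorem pair_E (x : V → ℚ) (v : V) : Γ.pair x (toQ (E v)) = ∑ w, x w * (Γ.inter w v : ℚ) := by
  simp only [pair, toQ, E, AddMonoidHom.coe_mk, ZeroHom.coe_mk]
  refine Finset.sum_congr rfl fun w _ => ?_
  rw [Finset.sum_eq_single v] <;> simp +contextual

theorem pair_eq_sum_E (x y : V → ℚ) : Γ.pair x y = ∑ v, y v * Γ.pair x (toQ (E v)) := by
  simp only [pair_E, Finset.mul_sum]
  simp only [pair]
  rw [Finset.sum_comm]
  refine Finset.sum_congr rfl fun v _ => Finset.sum_congr rfl fun w _ => by ring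

/-- `L` as a subgroup of `L ⊗ ℚ`. -/
def lattice : AddSubgroup (V → ℚ) := (toQ (V := V)).range

/-- The dual lattice `L'`. -/
def dual : AddSubgroup (V → ℚ) where
  carrier := {x | ∀ l : V → ℤ, ∃ k : ℤ, Γ.pair x (toQ l) = k}
  zero_mem' l := ⟨0, by simp [pair_zero_left]⟩
  add_mem' := by
    intro x y hx hy l
    obtain ⟨a, ha⟩ := hx l
    obtain ⟨b, hb⟩ := hy l
    exact ⟨a + b, by rw [pair_add_left, ha, hb]; push_cast; rfl⟩
  neg_mem' := by
    intro x hx l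
    obtain ⟨a, ha⟩ := hx l
    exact ⟨-a, by rw [pair_neg_left, ha]; push_cast; rfl⟩

/-- The group `H = L' / L`. -/
abbrev discriminantGroup : Type := Γ.dual ⧸ lattice.addSubgroupOf Γ.dual

/-- The Lipman cone `S' = {x ∈ L' : (x, E v) ≤ 0 for all v}`. -/
def lipmanCone : Set (V → ℚ) := {x | x ∈ Γ.dual ∧ ∀ v, Γ.pair x (toQ (E v)) ≤ 0}

/-- The elements of the Lipman cone that represent the class `h`. -/
def lipmanClass (h : Γ.discriminantGroup) : Set (V → ℚ) :=
  {x | x ∈ Γ.lipmanCone ∧ ∃ hx : x ∈ Γ.dual, (QuotientAddGroup.mk ⟨x, hx⟩ : Γ.discriminantGroup) = h}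

theorem lattice_le_dual : lattice ≤ Γ.dual := by
  rintro _ ⟨a, rfl⟩ l
  refine ⟨∑ v, ∑ w, a v * Γ.inter v w * l w, ?_⟩
  simp [pair, toQ]

theorem lipmanCone_nonneg {x : V → ℚ} (hx : x ∈ Γ.lipmanCone) : 0 ≤ x := by
  have hb : x⁻ = 0 := by
    by_contra hne
    have h1 := Γ.pair_self_neg hne
    have h2 : Γ.pair x x⁻ ≤ 0 := by
      rw [pair_eq_sum_E]
      exact Finset.sum_nonpos fun v _ =>
        mul_nonpos_of_nonneg_of_nonpos (negPart_nonneg x v) (hx.2 v)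
    have h3 : 0 ≤ Γ.pair x⁺ x⁻ := by
      refine Finset.sum_nonneg fun v _ => Finset.sum_nonneg fun w _ => ?_
      rcases eq_or_ne v w with rfl | hvw
      · have : x⁺ v * x⁻ v = 0 := by
          simp only [Pi.posPart_apply, Pi.negPart_apply]
          rcases le_total 0 (x v) with h | h
          · simp [negPart_eq_zero.2 h]
          · simp [posPart_eq_zero.2 h]
        rw [mul_right_comm, this, zero_mul]
      · have := Γ.inter_nonneg hvw
        have h4 : (0 : ℚ) ≤ Γ.inter v w := by exact_mod_cast this
        exact mul_nonneg (mul_nonneg (posPart_nonneg x v) h4) (negPart_nonneg x w)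
    have h4 : Γ.pair x x⁻ = Γ.pair x⁺ x⁻ - Γ.pair x⁻ x⁻ := by
      have := Γ.pair_add_left x⁺ (-x⁻) x⁻
      rwa [← sub_eq_add_neg, posPart_sub_negPart, pair_neg_left, ← sub_eq_add_neg] at this
    linarith
  exact negPart_eq_zero.1 hb

theorem mem_lipmanClass_add {h : Γ.discriminantGroup} {x y : V → ℚ}
    (hx : ∃ hx : x ∈ Γ.dual, (QuotientAddGroup.mk ⟨x, hx⟩ : Γ.discriminantGroup) = h)
    (hxy : y - x ∈ lattice (V := V)) (hy : ∀ v, Γ.pair y (toQ (E v)) ≤ 0) :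
    y ∈ Γ.lipmanClass h := by
  obtain ⟨hx, rfl⟩ := hx
  have hyd : y ∈ Γ.dual := by
    have := Γ.dual.add_mem hx (Γ.lattice_le_dual hxy)
    simpa using this
  refine ⟨⟨hyd, hy⟩, hyd, ?_⟩
  rw [eq_comm, QuotientAddGroup.eq, AddSubgroup.mem_addSubgroupOf]
  simpa [neg_add_eq_sub] using hxy

theorem lipmanClass_sub_mem {h : Γ.discriminantGroup} {x y : V → ℚ}
    (hx : x ∈ Γ.lipmanClass h) (hy : y ∈ Γ.lipmanClass h) : y - x ∈ lattice (V := V) := by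
  obtain ⟨_, hxd, hx⟩ := hx
  obtain ⟨_, hyd, hy⟩ := hy
  rw [← hy, QuotientAddGroup.eq, AddSubgroup.mem_addSubgroupOf] at hx
  simpa [neg_add_eq_sub] using hx

/-- The intersection matrix over `ℚ`. -/
noncomputable def matrixQ : Matrix V V ℚ := fun v w => (Γ.inter v w : ℚ)

theorem pair_E_eq_mulVec (x : V → ℚ) (v : V) :
    Γ.pair x (toQ (E v)) = (Γ.matrixQ.mulVec x) v := by
  rw [pair_E]
  simp only [Matrix.mulVec, dotProduct, matrixQ]
  refine Finset.sum_congr rfl fun w _ => ?_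
  rw [Γ.inter_comm]; ring

theorem isUnit_det : IsUnit Γ.matrixQ.det := by
  rw [isUnit_iff_ne_zero]
  intro h0
  obtain ⟨x, hx, hx0⟩ := Matrix.exists_mulVec_eq_zero_iff.2 h0
  have := Γ.pair_self_neg hx
  rw [pair_eq_sum_E] at this
  simp [pair_E_eq_mulVec, hx0] at this

theorem lipmanClass_nonempty (h : Γ.discriminantGroup) : (Γ.lipmanClass h).Nonempty := by
  obtain ⟨⟨r, hr⟩, rfl⟩ := QuotientAddGroup.mk_surjective h
  choose c hc using fun v => hr (E v)
  set A : Matrix V V ℤ := Matrix.of fun v w => Γ.inter v w with hA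
  have hdet : A.det ≠ 0 := by
    intro h0
    have := Γ.isUnit_det.ne_zero
    apply this
    have h1 : Γ.matrixQ = A.map (Int.cast : ℤ → ℚ) := by ext; simp [matrixQ, hA]
    rw [h1]
    have := (Int.castRingHom ℚ).map_det A
    simp only [h0, map_zero] at this
    exact this.symm
  set u : V → ℤ := A.adjugate.mulVec (fun v => -(A.det * |c v|)) with hu
  have hAu : A.mulVec u = fun v => -(A.det ^ 2 * |c v|) := by
    rw [hu, Matrix.mulVec_mulVec, Matrix.mul_adjugate, Matrix.smul_mulVec, Matrix.one_mulVec]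
    ext v; simp; ring
  refine ⟨r + toQ u, Γ.mem_lipmanClass_add ⟨hr, rfl⟩ ⟨u, by simp⟩ fun v => ?_⟩
  rw [pair_add_left, hc, pair_E_eq_mulVec]
  have h2 : Γ.matrixQ.mulVec (toQ u) v = ((A.mulVec u v : ℤ) : ℚ) := by
    simp [Matrix.mulVec, dotProduct, matrixQ, hA, toQ]
  rw [h2, hAu]
  have h3 : 1 ≤ A.det ^ 2 := by
    have := sq_pos_of_ne_zero hdet
    omega
  have h4 : c v + -(A.det ^ 2 * |c v|) ≤ 0 := by
    nlinarith [le_abs_self (c v), abs_nonneg (c v)]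
  exact_mod_cast h4

theorem inf_mem_lipmanClass {h : Γ.discriminantGroup} {x y : V → ℚ}
    (hx : x ∈ Γ.lipmanClass h) (hy : y ∈ Γ.lipmanClass h) : x ⊓ y ∈ Γ.lipmanClass h := by
  obtain ⟨l, hl⟩ := Γ.lipmanClass_sub_mem hx hy
  refine Γ.mem_lipmanClass_add hx.2 ⟨fun v => min 0 (l v), ?_⟩ fun v => ?_
  · ext v
    have h1 : (l v : ℚ) = y v - x v := congrFun hl v
    simp only [toQ, AddMonoidHom.coe_mk, ZeroHom.coe_mk, Pi.sub_apply, Pi.inf_apply]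
    push_cast
    rw [h1]
    rcases le_total (x v) (y v) with h | h
    · rw [min_eq_left (by linarith), inf_eq_left.2 h]; ring
    · rw [min_eq_right (by linarith), inf_eq_right.2 h]
  · have key : ∀ z : V → ℚ, x ⊓ y ≤ z → z v = (x ⊓ y) v → Γ.pair z (toQ (E v)) ≤ 0 →
        Γ.pair (x ⊓ y) (toQ (E v)) ≤ 0 := by
      intro z hz hzv hp
      refine le_trans ?_ hp
      rw [pair_E, pair_E]
      refine Finset.sum_le_sum fun w _ => ?_
      rcases eq_or_ne w v with rfl | hwv
      · rw [hzv]
      · have h4 : (0 : ℚ) ≤ Γ.inter w v := by exact_mod_cast Γ.inter_nonneg hwv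
        exact mul_le_mul_of_nonneg_right (hz w) h4
    rcases le_total (x v) (y v) with h | h
    · exact key x inf_le_left (by simp [h]) (hx.1.2 v)
    · exact key y inf_le_right (by simp [h]) (hy.1.2 v)

theorem exists_isLeast_lipmanClass (h : Γ.discriminantGroup) :
    ∃ x, IsLeast (Γ.lipmanClass h) x := by
  obtain ⟨x, hx, hmin⟩ := exists_minimalFor_of_wellFoundedLT (fun x => x ∈ Γ.lipmanClass h)
    (fun x : V → ℚ => ∑ v, ⌊x v⌋₊) (Γ.lipmanClass_nonempty h)
  refine ⟨x, hx, fun y hy => ?_⟩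
  have hz := Γ.inf_mem_lipmanClass hx hy
  have hle : ∀ v ∈ Finset.univ, ⌊(x ⊓ y) v⌋₊ ≤ ⌊x v⌋₊ := fun v _ =>
    Nat.floor_le_floor (inf_le_left (a := x v))
  have heq := (Finset.sum_eq_sum_iff_of_le hle).1
    (le_antisymm (Finset.sum_le_sum hle) (hmin hz (Finset.sum_le_sum hle)))
  obtain ⟨l, hl⟩ := Γ.lipmanClass_sub_mem hz hx
  intro v
  have h0 : 0 ≤ (x ⊓ y) v := Γ.lipmanCone_nonneg hz.1 v
  have h0' : 0 ≤ x v := Γ.lipmanCone_nonneg hx.1 v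
  have h1 : (l v : ℚ) = x v - (x ⊓ y) v := congrFun hl v
  have h2 := heq v (Finset.mem_univ v)
  have h3 := Nat.floor_le h0
  have h4 := Nat.lt_floor_add_one (x v)
  rw [← h2] at h4
  have h5 : l v < 1 := by
    have : (l v : ℚ) < 1 := by linarith
    exact_mod_cast this
  have h6 : (l v : ℚ) ≤ 0 := by exact_mod_cast Int.lt_add_one_iff.1 (by simpa using h5)
  have h7 : (x ⊓ y) v ≤ y v := inf_le_right (a := x v)
  linarith

/-- `s_h`: the smallest element of the Lipman cone in the class `h`. -/
noncomputable def sH (h : Γ.discriminantGroup) : V → ℚ := (Γ.exists_isLeast_lipmanClass h).choose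

theorem sH_isLeast (h : Γ.discriminantGroup) : IsLeast (Γ.lipmanClass h) (Γ.sH h) :=
  (Γ.exists_isLeast_lipmanClass h).choose_spec

/-- The anticanonical cycle `Z_K`, determined by the adjunction formulae. -/
noncomputable def ZK : V → ℚ := Γ.matrixQ⁻¹.mulVec fun v => (Γ.inter v v : ℚ) + 2

theorem adjunction (v : V) :
    Γ.pair Γ.ZK (toQ (E v)) = Γ.pair (toQ (E v)) (toQ (E v)) + 2 := by
  rw [pair_E_eq_mulVec, ZK, Matrix.mulVec_mulVec, Matrix.mul_nonsing_inv _ Γ.isUnit_det,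
    Matrix.one_mulVec, pair_E]
  simp [toQ, E, Pi.single_apply]

/-- The distinguished characteristic element `k_h = -Z_K + 2 s_h`. -/
noncomputable def kH (h : Γ.discriminantGroup) : V → ℚ := -Γ.ZK + (2 : ℚ) • Γ.sH h

/-- The Riemann-Roch weight function `χ_h(l) = -(l, l + k_h)/2` on `L`; this number is an
integer, see `chi_cast`. -/
noncomputable def chi (h : Γ.discriminantGroup) (l : V → ℤ) : ℤ :=
  ⌊-(Γ.pair (toQ l) (toQ l + Γ.kH h)) / 2⌋

theorem chi_cast (h : Γ.discriminantGroup) (l : V → ℤ) :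
    (Γ.chi h l : ℚ) = -(Γ.pair (toQ l) (toQ l + Γ.kH h)) / 2 := by
  suffices H : ∃ k : ℤ, -(Γ.pair (toQ l) (toQ l + Γ.kH h)) / 2 = k by
    obtain ⟨k, hk⟩ := H
    rw [chi, hk, Int.floor_intCast]
  have hs : Γ.sH h ∈ Γ.dual := (Γ.sH_isLeast h).1.1.1
  have hl : ∀ l l' : V → ℤ, ∃ k : ℤ, Γ.pair (toQ l) (toQ l') = k := fun l l' =>
    Γ.lattice_le_dual ⟨l, rfl⟩ l'
  -- the set of all `l` at which the value is an integer is a subgroup that contains the basis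
  let P : AddSubgroup (V → ℤ) :=
    { carrier := {l | ∃ k : ℤ, -(Γ.pair (toQ l) (toQ l + Γ.kH h)) / 2 = k}
      zero_mem' := ⟨0, by simp [pair_zero_left]⟩
      add_mem' := by
        rintro a b ⟨k, hk⟩ ⟨k', hk'⟩
        obtain ⟨m, hm⟩ := hl a b
        refine ⟨k + k' - m, ?_⟩
        have hm' : Γ.pair (toQ b) (toQ a) = m := by rw [pair_comm, hm]
        simp only [map_add, pair_add_left, pair_add_right] at hk hk' ⊢
        push_cast
        rw [hm, hm', ← hk, ← hk']
        ring
      neg_mem' := by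
        rintro a ⟨k, hk⟩
        obtain ⟨m, hm⟩ := hl a a
        refine ⟨-k - m, ?_⟩
        simp only [map_neg, pair_neg_left, pair_add_right, pair_neg_right] at hk ⊢
        push_cast
        rw [← hk, ← hm]
        ring }
  have hE : ∀ v, E v ∈ P := by
    intro v
    obtain ⟨m, hm⟩ := hs (E v)
    refine ⟨1 - m, ?_⟩
    have h1 := Γ.adjunction v
    rw [kH, pair_add_right, pair_add_right, pair_neg_right, pair_smul_right,
      Γ.pair_comm _ Γ.ZK, h1, Γ.pair_comm _ (Γ.sH h), hm]
    push_cast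
    ring
  have hsum : l = ∑ v, l v • E v := by
    ext w
    simp [E, Finset.sum_apply, Pi.single_apply]
  change l ∈ P
  rw [hsum]
  exact P.sum_mem fun v _ => P.zsmul_mem (hE v) _

theorem chi_ge (h : Γ.discriminantGroup) (l : V → ℤ) :
    ⌊Γ.pair (Γ.kH h) (Γ.kH h) / 8⌋ ≤ Γ.chi h l := by
  refine Int.floor_le_floor ?_
  have h1 := Γ.pair_self_nonpos (toQ l + (1 / 2 : ℚ) • Γ.kH h)
  simp only [pair_add_left, pair_add_right, pair_smul_left, pair_smul_right] at h1 ⊢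
  rw [Γ.pair_comm (Γ.kH h) (toQ l)] at h1
  linarith

/-! ### Cubes, sublevel sets and the filtration -/

/-- The cube `(l, I)`, with vertices `l + ∑ v ∈ J, E v` for `J ⊆ I`. -/
def cube (l : V → ℤ) (I : Finset V) : Set (V → ℝ) :=
  {x | ∀ v, if v ∈ I then (l v : ℝ) ≤ x v ∧ x v ≤ l v + 1 else x v = l v}

/-- The weight of a cube: the maximum of `χ_h` over its vertices. -/
noncomputable def weight (h : Γ.discriminantGroup) (l : V → ℤ) (I : Finset V) : ℤ :=
  I.powerset.sup' ⟨∅, Finset.empty_mem_powerset I⟩ fun J => Γ.chi h (l + ∑ v ∈ J, E v)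

/-- `S_n`, inside the first quadrant: the union of all cubes of weight at most `n`, intersected
with `(ℝ≥0)^V`. -/
def sublevel (h : Γ.discriminantGroup) (n : ℤ) : Set (V → ℝ) :=
  {x | 0 ≤ x ∧ ∃ l I, Γ.weight h l I ≤ n ∧ x ∈ cube l I}

/-- `X_{-d}`: the union of all cubes `(l, I)` with `l ≥ 0` and `(s, l) ≤ -d`. -/
def filtered (s : V → ℚ) (d : ℕ) : Set (V → ℝ) :=
  {x | ∃ l I, 0 ≤ l ∧ Γ.pair s (toQ l) ≤ -d ∧ x ∈ cube l I}

/-- The minimum of `χ_h` over the lattice points of `X_{-d}`. -/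
noncomputable def minChi (h : Γ.discriminantGroup) (s : V → ℚ) (d : ℕ) : ℤ :=
  sInf {n | ∃ l : V → ℤ, 0 ≤ l ∧ Γ.pair s (toQ l) ≤ -d ∧ Γ.chi h l = n}

/-! ### Homology and the terms `E^∞` -/

/-- Singular homology, with integer coefficients, of a subspace of `ℝ^V`. -/
noncomputable abbrev homology (b : ℕ) (A : Set (V → ℝ)) : ModuleCat.{0} ℤ :=
  ((AlgebraicTopology.singularHomologyFunctor (ModuleCat.{0} ℤ) b).obj (ModuleCat.of ℤ ℤ)).obj
    (TopCat.of A)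

/-- The map induced in homology by an inclusion of subspaces. -/
noncomputable def homologyMap (b : ℕ) {A B : Set (V → ℝ)} (hAB : A ⊆ B) :
    homology b A →ₗ[ℤ] homology b B :=
  (((AlgebraicTopology.singularHomologyFunctor (ModuleCat.{0} ℤ) b).obj (ModuleCat.of ℤ ℤ)).map
    (TopCat.ofHom ⟨Set.inclusion hAB, continuous_inclusion hAB⟩)).hom

/-- `F_{-d} H_b(S_n)`: the image of `H_b(S_n ∩ X_{-d}) → H_b(S_n)`. -/
noncomputable def F (h : Γ.discriminantGroup) (s : V → ℚ) (n : ℤ) (b d : ℕ) :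
    Submodule ℤ (homology b (Γ.sublevel h n)) :=
  LinearMap.range (homologyMap b
    (Set.inter_subset_left : Γ.sublevel h n ∩ Γ.filtered s d ⊆ Γ.sublevel h n))

/-- The rank of `(E^∞_{-d,q})_n = F_{-d} H_b(S_n) / F_{-d-1} H_b(S_n)`, where `b = -d + q`. -/
noncomputable def rankEInfty (h : Γ.discriminantGroup) (s : V → ℚ) (n : ℤ) (b d : ℕ) : ℕ :=
  Module.finrank ℤ (Γ.F h s n b d ⧸ (Γ.F h s n b (d + 1)).submoduleOf (Γ.F h s n b d))

theorem sublevel_eq_empty (h : Γ.discriminantGroup) {n : ℤ}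
    (hn : n < ⌊Γ.pair (Γ.kH h) (Γ.kH h) / 8⌋) : Γ.sublevel h n = ∅ := by
  rw [Set.eq_empty_iff_forall_notMem]
  rintro x ⟨-, l, I, hw, -⟩
  have h1 : Γ.chi h (l + ∑ v ∈ (∅ : Finset V), E v) ≤ Γ.weight h l I :=
    Finset.le_sup' (fun J => Γ.chi h (l + ∑ v ∈ J, E v)) (Finset.empty_mem_powerset I)
  have h2 := Γ.chi_ge h (l + ∑ v ∈ (∅ : Finset V), E v)
  omega

open CategoryTheory Limits AlgebraicTopology in
theorem subsingleton_homology_of_isEmpty {W : Type} (b : ℕ) (A : Set (W → ℝ)) [IsEmpty A] :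
    Subsingleton (homology b A) := by
  have : IsZero (homology b A) := by
    have : TotallyDisconnectedSpace (TopCat.of A) :=
      inferInstanceAs (TotallyDisconnectedSpace A)
    rcases eq_or_ne b 0 with rfl | hb
    · have e := singularHomologyFunctorZeroOfTotallyDisconnectedSpace (ModuleCat.{0} ℤ)
        (ModuleCat.of ℤ ℤ) (TopCat.of A)
      refine IsZero.of_iso ?_ e
      have : IsEmpty (TopCat.of A) := inferInstanceAs (IsEmpty A)
      rw [IsZero.iff_id_eq_zero]
      exact Sigma.hom_ext _ _ fun a => isEmptyElim a
    · exact isZero_singularHomologyFunctor_of_totallyDisconnectedSpace _ b _ _ hb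
  exact ModuleCat.subsingleton_of_isZero this

theorem rankEInfty_eq_zero (h : Γ.discriminantGroup) (s : V → ℚ) {n : ℤ} (b d : ℕ)
    (hn : n < ⌊Γ.pair (Γ.kH h) (Γ.kH h) / 8⌋) : Γ.rankEInfty h s n b d = 0 := by
  have : IsEmpty (Γ.sublevel h n) := by
    rw [Γ.sublevel_eq_empty h hn]; infer_instance
  have := subsingleton_homology_of_isEmpty b (Γ.sublevel h n)
  have : Subsingleton (Γ.F h s n b d) := inferInstance
  exact Module.finrank_zero_of_subsingleton

/-! ### The Poincaré series

The ring is `ℤ[ħ]((Q))[[T]]`. -/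

/-- Laurent series in `Q` over `ℤ[ħ]`. -/
abbrev QSeries : Type := LaurentSeries ℤ[X]

/-- The monomial `Q^n`. -/
noncomputable def Q (n : ℤ) : QSeries := HahnSeries.single n 1

/-- The series `1 / (1 - Q) = ∑_{n ≥ 0} Q^n`. -/
noncomputable def geomQ : QSeries :=
  HahnSeries.ofPowerSeries ℤ ℤ[X] (PowerSeries.mk fun _ => 1)

theorem geomQ_mul : geomQ * (1 - Q 1) = 1 := by
  have h := congrArg (HahnSeries.ofPowerSeries ℤ ℤ[X]) (PowerSeries.mk_one_mul_one_sub_eq_one ℤ[X])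
  rw [map_mul, map_sub, map_one, HahnSeries.ofPowerSeries_X] at h
  exact h

/-- `∑_b rank (E^∞_{-d,q})_n ħ^b` with `b = -d + q`. All homology groups in degrees above `|V|`,
the dimension of the ambient space of the cubical complex `S_n`, vanish. -/
noncomputable def coeffEInfty (h : Γ.discriminantGroup) (s : V → ℚ) (d : ℕ) (n : ℤ) : ℤ[X] :=
  ∑ b ∈ Finset.range (Fintype.card V + 1),
    Polynomial.C (Γ.rankEInfty h s n b d : ℤ) * Polynomial.X ^ b

theorem bddBelow_support (h : Γ.discriminantGroup) (s : V → ℚ) (d : ℕ) :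
    BddBelow (Function.support (Γ.coeffEInfty h s d)) := by
  refine ⟨⌊Γ.pair (Γ.kH h) (Γ.kH h) / 8⌋, fun n hn => ?_⟩
  by_contra hlt
  exact hn (Finset.sum_eq_zero fun b _ => by
    rw [Γ.rankEInfty_eq_zero h s b d (not_le.1 hlt)]; simp)

/-- The Poincaré series `PE_∞(T, Q, ħ) = ∑ rank (E^∞_{-d,q})_n T^d Q^n ħ^{-d+q}`. -/
noncomputable def PEInfty (h : Γ.discriminantGroup) (s : V → ℚ) : PowerSeries QSeries :=
  PowerSeries.mk fun d => HahnSeries.ofSuppBddBelow (Γ.coeffEInfty h s d) (Γ.bddBelow_support h s d)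

theorem bddBelow_support_one (h : Γ.discriminantGroup) (s : V → ℚ) :
    BddBelow (Function.support fun n => ∑ᶠ d, Γ.coeffEInfty h s d n) := by
  refine ⟨⌊Γ.pair (Γ.kH h) (Γ.kH h) / 8⌋, fun n hn => ?_⟩
  by_contra hlt
  refine hn (finsum_eq_zero_of_forall_eq_zero fun d => Finset.sum_eq_zero fun b _ => ?_)
  rw [Γ.rankEInfty_eq_zero h s b d (not_le.1 hlt)]; simp

/-- `PE_∞(1, Q, ħ)`: for each `n` the coefficients of `T^d Q^n` are summed over all `d`. -/
noncomputable def PEInftyOne (h : Γ.discriminantGroup) (s : V → ℚ) : QSeries :=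
  HahnSeries.ofSuppBddBelow (fun n => ∑ᶠ d, Γ.coeffEInfty h s d n) (Γ.bddBelow_support_one h s)

/-- The theta-like series `∑_{m ≥ 0} T^{c m} Q^{χ_h(l + m t) - χ_h(l)}` for `c ≥ 1`. -/
noncomputable def thetaSeries (h : Γ.discriminantGroup) (t l : V → ℤ) (c : ℕ) :
    PowerSeries QSeries :=
  PowerSeries.mk fun j => ∑ m ∈ Finset.range (j + 1),
    if c * m = j then Q (Γ.chi h (l + m • t) - Γ.chi h l) else 0

end ResolutionGraph

/-! For all large `n` the space S_n is contractible, so only H_0 = ℤ survives, and F_{-d}H_0 is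
everything or zero according to whether S_n meets X_{-d}, that is, whether min(d) ≤ n. Hence, once
min(d) is large, the coefficient of T^d in PE_∞ is (Q^{min(d)} - Q^{min(d+1)})/(1-Q)
(`coeff_PEInfty_of_le_minChi`). Negative definiteness makes min(d) tend to infinity, so this covers
all large d. Contractibility (`exists_contractibleSpace_sublevel`) comes from the truncations x ↦
min(x, τz), where (z, E_v) = -1 for all v and τ decreases to 0.

The values -(s,l) are the multiples of e, so min(d) only jumps there. For large k, min(ek) equals
the minimum of χ_h on the whole slice -(s,l) = ek (`exists_forall_chi_eq_minChi`). Translation by s̃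
= Ns carries this slice to the one for k + p and changes χ_h by a constant on it, so minimizers go
to minimizers (`IsSliceMin.add`). Thus p minimizers l_q, one on each of p consecutive slices,
determine all later minima, and the differences of consecutive minima assemble into the theta-like
sum (`coeff_telescope`).

At T = 1 each large n is counted once, by the unique d with min(d) ≤ n < min(d+1). -/

namespace ResolutionGraph

/-! ### Homology of contractible subspaces. -/

section Homology

open CategoryTheory Limits AlgebraicTopology

variable {W : Type}

/-- The map induced in homology by a continuous map. -/
noncomputable def inducedMap (b : ℕ) {A B : TopCat.{0}} (f : A ⟶ B) :
    ((singularHomologyFunctor (ModuleCat.{0} ℤ) b).obj (ModuleCat.of ℤ ℤ)).obj A ⟶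
      ((singularHomologyFunctor (ModuleCat.{0} ℤ) b).obj (ModuleCat.of ℤ ℤ)).obj B :=
  ((singularHomologyFunctor (ModuleCat.{0} ℤ) b).obj (ModuleCat.of ℤ ℤ)).map f

theorem inducedMap_eq_of_homotopic (b : ℕ) {A B : TopCat.{0}} {f g : A ⟶ B}
    (H : f.hom.Homotopic g.hom) : inducedMap b f = inducedMap b g := by
  obtain ⟨H⟩ := H
  exact TopCat.Homotopy.congr_homologyMap_singularChainComplexFunctor (f := f) (g := g) H
    (ModuleCat.of ℤ ℤ) b

theorem homotopic_id_const {X : Type} [TopologicalSpace X] [ContractibleSpace X] (x : X) :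
    (ContinuousMap.id X).Homotopic (ContinuousMap.const X x) := by
  obtain ⟨y, hy⟩ := id_nullhomotopic X
  exact hy.trans (ContinuousMap.homotopic_const_iff.2 (PathConnectedSpace.joined y x))

/-- Up to homotopy the identity factors through a point, whose homology in positive degree is zero.
-/
theorem subsingleton_homology_of_contractibleSpace {b : ℕ} (hb : b ≠ 0) (A : Set (W → ℝ))
    [ContractibleSpace A] : Subsingleton (homology b A) := by
  obtain ⟨x⟩ : Nonempty A := inferInstance
  have h1 : inducedMap b (𝟙 (TopCat.of A)) = inducedMap b
      (TopCat.ofHom (ContinuousMap.const A PUnit.unit.{1}) ≫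
        TopCat.ofHom (ContinuousMap.const PUnit.{1} x)) :=
    inducedMap_eq_of_homotopic b (homotopic_id_const x)
  have h2 : IsZero (((singularHomologyFunctor (ModuleCat.{0} ℤ) b).obj (ModuleCat.of ℤ ℤ)).obj
      (TopCat.of PUnit.{1})) :=
    have : TotallyDisconnectedSpace (TopCat.of PUnit.{1}) :=
      inferInstanceAs (TotallyDisconnectedSpace PUnit.{1})
    isZero_singularHomologyFunctor_of_totallyDisconnectedSpace _ b _ _ hb
  have h3 : IsZero (homology b A) := by
    rw [IsZero.iff_id_eq_zero]
    refine (CategoryTheory.Functor.map_id _ _).symm.trans (h1.trans ?_)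
    exact (CategoryTheory.Functor.map_comp _ _ _).trans
      ((congrArg (· ≫ _) (h2.eq_zero_of_tgt _)).trans zero_comp)
  exact ModuleCat.subsingleton_of_isZero h3

theorem finrank_homology_zero (A : Set (W → ℝ)) [PathConnectedSpace A] :
    Module.finrank ℤ (homology 0 A) = 1 := by
  have : PathConnectedSpace (TopCat.of A) := inferInstanceAs (PathConnectedSpace A)
  have e := asIso ((TopCat.of A).singularHomology₀ε (ModuleCat.of ℤ ℤ))
  rw [LinearEquiv.finrank_eq (e.toLinearEquiv)]
  exact Module.finrank_self ℤ

/-- The constant map from `B` to a point of `A` is a right inverse of the inclusion up to homotopy.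
-/
theorem homologyMap_zero_surjective {A B : Set (W → ℝ)} (hAB : A ⊆ B) (hA : A.Nonempty)
    [ContractibleSpace B] : Function.Surjective (homologyMap 0 hAB) := by
  obtain ⟨a, ha⟩ := hA
  have h1 : inducedMap 0 (𝟙 (TopCat.of B)) = inducedMap 0
      (TopCat.ofHom (ContinuousMap.const B (⟨a, ha⟩ : A)) ≫
        TopCat.ofHom ⟨Set.inclusion hAB, continuous_inclusion hAB⟩) :=
    inducedMap_eq_of_homotopic 0 (homotopic_id_const (⟨a, hAB ha⟩ : B))
  intro y
  refine ⟨(inducedMap 0 (TopCat.ofHom (ContinuousMap.const B (⟨a, ha⟩ : A)))).hom y, ?_⟩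
  have h2 : (inducedMap 0 (𝟙 (TopCat.of B))).hom y = y := by
    simp [inducedMap]
  rw [h1] at h2
  simpa [inducedMap, homologyMap] using h2

end Homology

/-! ### Boundedness and contractibility of the sublevel sets. -/

section Geometry

variable {V : Type} [Fintype V] [DecidableEq V] (Γ : ResolutionGraph V)

/-- If x_v = 0, then (x, E_v) ≤ 0 is a sum of nonnegative terms, so x vanishes at all neighbours of
v, and by connectedness everywhere. -/
theorem pos_of_mem_lipmanCone {x : V → ℚ} (hx : x ∈ Γ.lipmanCone) (hx0 : x ≠ 0) (v : V) :
    0 < x v := by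
  have hnn := Γ.lipmanCone_nonneg hx
  refine lt_of_le_of_ne (hnn v) fun hv => hx0 ?_
  have step : ∀ a b, Γ.graph.Adj a b → x a = 0 → x b = 0 := by
    intro a b hab ha
    have hterm : ∀ w ∈ Finset.univ, 0 ≤ x w * (Γ.inter w a : ℚ) := by
      intro w _
      rcases eq_or_ne w a with rfl | hwa
      · simp [ha]
      · exact mul_nonneg (hnn w) (by exact_mod_cast Γ.inter_nonneg hwa)
    have hle := hx.2 a
    rw [pair_E] at hle
    have h0 := (Finset.sum_eq_zero_iff_of_nonneg hterm).1
      (le_antisymm hle (Finset.sum_nonneg hterm)) b (Finset.mem_univ b)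
    have h1 : Γ.inter b a = 1 := by
      simp [inter, intersectionMatrix, hab.ne', hab.symm]
    simpa [h1] using h0
  have walk : ∀ a b, Γ.graph.Walk a b → x a = 0 → x b = 0 := by
    intro a b p
    induction p with
    | nil => exact id
    | cons hab _ ih => exact fun ha => ih (step _ _ hab ha)
  ext w
  obtain ⟨p⟩ := Γ.isTree.1.preconnected v w
  exact walk v w p hv.symm

/-- There is an element of the Lipman cone whose product with each `E v` is `-1`. -/
theorem exists_pair_E_eq_neg_one :
    ∃ z : V → ℚ, (∀ v, Γ.pair z (toQ (E v)) = -1) ∧ ∀ v, 0 < z v := by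
  have hz : ∀ v, Γ.pair (Γ.matrixQ⁻¹.mulVec fun _ => -1) (toQ (E v)) = -1 := by
    intro v
    rw [pair_E_eq_mulVec, Matrix.mulVec_mulVec, Matrix.mul_nonsing_inv _ Γ.isUnit_det,
      Matrix.one_mulVec]
  refine ⟨_, hz, fun v => Γ.pos_of_mem_lipmanCone ⟨fun l => ⟨-∑ v, l v, ?_⟩, fun v => ?_⟩ ?_ v⟩
  · rw [pair_eq_sum_E]
    simp only [hz]
    simp [toQ]
  · rw [hz]; norm_num
  · intro h0
    have := hz v
    rw [h0, pair_zero_left] at this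
    norm_num at this

/-- Cauchy–Schwarz, from the value of the form at (x,x)y - (x,y)x. -/
theorem pair_sq_le (x y : V → ℚ) : Γ.pair x y ^ 2 ≤ Γ.pair x x * Γ.pair y y := by
  rcases eq_or_ne x 0 with rfl | hx
  · simp [pair_zero_left]
  · have ha := Γ.pair_self_neg hx
    have h1 := Γ.pair_self_nonpos (Γ.pair x x • y + (-Γ.pair x y) • x)
    simp only [pair_add_left, pair_add_right, pair_smul_left, pair_smul_right,
      Γ.pair_comm y x] at h1
    by_contra! hlt
    have := mul_neg_of_pos_of_neg (sub_pos.2 hlt) ha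
    nlinarith

/-- Completing the square, χ_h(l) ≤ n bounds -(y,y) for y = l + k_h/2, and Cauchy–Schwarz then
bounds every linear functional. Applied to s it makes min(d) unbounded; applied to z it bounds S_n.
-/
theorem exists_abs_pair_le (h : Γ.discriminantGroup) (w : V → ℚ) (n : ℤ) :
    ∃ B : ℚ, ∀ l : V → ℤ, Γ.chi h l ≤ n → |Γ.pair w (toQ l)| ≤ B := by
  refine ⟨1 + -Γ.pair w w * (2 * n - Γ.pair (Γ.kH h) (Γ.kH h) / 4) + |Γ.pair w (Γ.kH h) / 2|,
    fun l hl => ?_⟩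
  have h1 : (Γ.chi h l : ℚ) ≤ n := by exact_mod_cast hl
  rw [chi_cast] at h1
  have h2 := Γ.pair_sq_le w (toQ l + (1 / 2 : ℚ) • Γ.kH h)
  have h3 : -Γ.pair (toQ l + (1 / 2 : ℚ) • Γ.kH h) (toQ l + (1 / 2 : ℚ) • Γ.kH h) ≤
      2 * n - Γ.pair (Γ.kH h) (Γ.kH h) / 4 := by
    simp only [pair_add_left, pair_add_right, pair_smul_left, pair_smul_right,
      Γ.pair_comm (Γ.kH h) (toQ l)] at h1 ⊢
    linarith
  have h4 := mul_le_mul_of_nonneg_left h3 (neg_nonneg.2 (Γ.pair_self_nonpos w))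
  have h5 : Γ.pair w (toQ l) = Γ.pair w (toQ l + (1 / 2 : ℚ) • Γ.kH h)
      - Γ.pair w (Γ.kH h) / 2 := by
    rw [pair_add_right, pair_smul_right]; ring
  rw [h5]
  set q := Γ.pair w (toQ l + (1 / 2 : ℚ) • Γ.kH h)
  have h6 : |q| ≤ 1 + q ^ 2 := by
    rw [← sq_abs q]; nlinarith [sq_nonneg (|q| - 1), abs_nonneg q]
  calc |q - Γ.pair w (Γ.kH h) / 2| ≤ |q| + |Γ.pair w (Γ.kH h) / 2| := abs_sub _ _
    _ ≤ _ := by linarith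

theorem chi_add (h : Γ.discriminantGroup) (l u : V → ℤ) :
    (Γ.chi h (l + u) : ℚ) = Γ.chi h l + Γ.chi h u - Γ.pair (toQ l) (toQ u) := by
  simp only [chi_cast, map_add, pair_add_left, pair_add_right, Γ.pair_comm (toQ u) (toQ l)]
  ring

theorem sum_E_apply {W : Type} [DecidableEq W] (J : Finset W) (v : W) :
    (∑ w ∈ J, E w) v = if v ∈ J then (1 : ℤ) else 0 := by
  simp [E, Finset.sum_apply, Pi.single_apply]

/-- The roundings of x, coordinate by coordinate, are the vertices of the smallest cube containing
x, which is a face of every other such cube. -/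
theorem mem_sublevel_iff (h : Γ.discriminantGroup) (n : ℤ) (x : V → ℝ) :
    x ∈ Γ.sublevel h n ↔
      0 ≤ x ∧ ∀ l : V → ℤ, (∀ v, l v = ⌊x v⌋ ∨ l v = ⌈x v⌉) → Γ.chi h l ≤ n := by
  refine and_congr_right fun _ => ⟨?_, fun hl => ?_⟩
  · rintro ⟨l₀, I, hw, hx⟩ l hl
    refine le_trans ?_ hw
    have hlv : l = l₀ + ∑ v ∈ I.filter fun v => l v = l₀ v + 1, E v := by
      ext v
      rw [Pi.add_apply, sum_E_apply]
      have hxv := hx v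
      by_cases hv : v ∈ I
      · rw [if_pos hv] at hxv
        have h1 : l₀ v ≤ ⌊x v⌋ := Int.le_floor.2 hxv.1
        have h2 : ⌈x v⌉ ≤ l₀ v + 1 := Int.ceil_le.2 (by push_cast; exact hxv.2)
        have h3 := Int.floor_le_ceil (x v)
        have h4 := hl v
        simp only [Finset.mem_filter, hv, true_and]
        split_ifs <;> omega
      · rw [if_neg hv] at hxv
        have h4 := hl v
        rw [hxv] at h4
        simpa [hv] using h4
    conv_lhs => rw [hlv]
    exact Finset.le_sup' (fun J => Γ.chi h (l₀ + ∑ v ∈ J, E v))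
      (Finset.mem_powerset.2 (Finset.filter_subset _ _))
  · refine ⟨fun v => ⌊x v⌋, Finset.univ.filter fun v => ⌊x v⌋ ≠ ⌈x v⌉,
      Finset.sup'_le _ _ fun J hJ => hl _ fun v => ?_, fun v => ?_⟩
    · rw [Pi.add_apply, sum_E_apply]
      split_ifs with hv
      · have h1 := (Finset.mem_filter.1 (Finset.mem_powerset.1 hJ hv)).2
        have h2 := Int.ceil_le_floor_add_one (x v)
        have h3 := Int.floor_le_ceil (x v)
        right; omega
      · left; simp
    · split_ifs with hv
      · exact ⟨Int.floor_le _, (Int.lt_floor_add_one _).le⟩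
      · have h1 : ⌊x v⌋ = ⌈x v⌉ := by simpa using hv
        refine le_antisymm ?_ (Int.floor_le _)
        exact (Int.le_ceil _).trans_eq (congrArg Int.cast h1.symm)

theorem pair_antitone {s : V → ℚ} (hs : s ∈ Γ.lipmanCone) {l l' : V → ℤ} (hl : l ≤ l') :
    Γ.pair s (toQ l') ≤ Γ.pair s (toQ l) := by
  rw [pair_eq_sum_E, Γ.pair_eq_sum_E s (toQ l)]
  exact Finset.sum_le_sum fun v _ =>
    mul_le_mul_of_nonpos_right (by simpa [toQ] using hl v) (hs.2 v)

/-- A point can be replaced by its coordinatewise floor: this is a vertex of its smallest cube, and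
it dominates the base point of any cube containing the point, so (s, ·) ≤ -d persists. -/
theorem sublevel_inter_filtered_nonempty_iff (h : Γ.discriminantGroup) {s : V → ℚ}
    (hs : s ∈ Γ.lipmanCone) (n : ℤ) (d : ℕ) :
    (Γ.sublevel h n ∩ Γ.filtered s d).Nonempty ↔
      ∃ l : V → ℤ, 0 ≤ l ∧ Γ.pair s (toQ l) ≤ -d ∧ Γ.chi h l ≤ n := by
  constructor
  · rintro ⟨x, hx, l, I, hl0, hld, hxl⟩
    have hle : l ≤ fun v => ⌊x v⌋ := fun v => by
      have := hxl v
      split_ifs at this with hv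
      · exact Int.le_floor.2 this.1
      · simp [this]
    exact ⟨fun v => ⌊x v⌋, hl0.trans hle, (Γ.pair_antitone hs hle).trans hld,
      ((Γ.mem_sublevel_iff h n x).1 hx).2 _ fun v => Or.inl rfl⟩
  · rintro ⟨l, hl0, hld, hln⟩
    refine ⟨fun v => l v, (Γ.mem_sublevel_iff h n _).2
      ⟨fun v => by simpa using hl0 v, fun l' hl' => ?_⟩, l, ∅, hl0, hld, fun v => by simp⟩
    have : l' = l := by ext v; simpa using hl' v
    rwa [this]

/-- Far out along a ray `τ ↦ τ • z` with `(z, E v) = -1`, the function `χ_h` increases. -/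
theorem exists_chi_le_chi_add (h : Γ.discriminantGroup) {z : V → ℚ}
    (hz : ∀ v, Γ.pair z (toQ (E v)) = -1) :
    ∃ T : ℝ, ∀ τ, T ≤ τ → ∀ l u : V → ℤ, 0 ≤ u → (∀ v, (l v : ℝ) ≤ τ * z v + 1) →
      (∀ v, u v ≠ 0 → τ * z v - 1 ≤ l v) → Γ.chi h l ≤ Γ.chi h (l + u) := by
  -- The threshold dominates, for each v, the rounding error in (l, E_v) ≈ -τ plus the contribution
  -- of k_h/2.
  refine ⟨∑ v, ((∑ w, |(Γ.inter w v : ℝ)|) + |(Γ.pair (Γ.kH h) (toQ (E v)) / 2 : ℝ)|),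
    fun τ hτ l u hu hl hlu => ?_⟩
  have key : ∀ v, u v ≠ 0 →
      Γ.pair (toQ l) (toQ (E v)) + Γ.pair (Γ.kH h) (toQ (E v)) / 2 ≤ 0 := by
    intro v hv
    have h1 : ((Γ.pair (toQ l) (toQ (E v)) : ℚ) : ℝ) ≤ -τ + ∑ w, |(Γ.inter w v : ℝ)| := by
      have h2 : -τ = ∑ w, τ * z w * (Γ.inter w v : ℝ) := by
        have h3 : (∑ w, (z w : ℝ) * (Γ.inter w v : ℝ)) = -1 := by
          exact_mod_cast (Γ.pair_E z v).symm.trans (hz v)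
        simp only [mul_assoc, ← Finset.mul_sum, h3]
        ring
      rw [h2, ← Finset.sum_add_distrib, pair_E]
      push_cast
      refine Finset.sum_le_sum fun w _ => ?_
      simp only [toQ, AddMonoidHom.coe_mk, ZeroHom.coe_mk, Rat.cast_intCast]
      -- The diagonal entry may be negative, so l_v needs a two-sided estimate, available since u_v
      -- ≠ 0. Off the diagonal the entries are nonnegative and the upper bound on l_w suffices.
      rcases eq_or_ne w v with rfl | hwv
      · have h4 : |(l w : ℝ) - τ * z w| ≤ 1 := by
          rw [abs_le]; constructor <;> linarith [hl w, hlu w hv]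
        have h5 := mul_le_mul_of_nonneg_right h4 (abs_nonneg (Γ.inter w w : ℝ))
        rw [← abs_mul, one_mul] at h5
        linarith [le_abs_self (((l w : ℝ) - τ * z w) * (Γ.inter w w : ℝ))]
      · have h4 : (0 : ℝ) ≤ Γ.inter w v := by exact_mod_cast Γ.inter_nonneg hwv
        rw [abs_of_nonneg h4]
        nlinarith [hl w]
    have h2 := Finset.single_le_sum (f := fun v => (∑ w, |(Γ.inter w v : ℝ)|) +
      |(Γ.pair (Γ.kH h) (toQ (E v)) / 2 : ℝ)|) (fun v _ => by positivity) (Finset.mem_univ v)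
    have h3 := le_abs_self (Γ.pair (Γ.kH h) (toQ (E v)) / 2 : ℝ)
    have h4 : ((Γ.pair (toQ l) (toQ (E v)) + Γ.pair (Γ.kH h) (toQ (E v)) / 2 : ℚ) : ℝ) ≤ 0 := by
      push_cast
      linarith
    exact_mod_cast h4
  have h1 := Γ.chi_add h l u
  have h2 := Γ.pair_self_nonpos (toQ u)
  have h3 : Γ.pair (toQ l) (toQ u) + Γ.pair (Γ.kH h) (toQ u) / 2 ≤ 0 := by
    rw [pair_eq_sum_E, Γ.pair_eq_sum_E (Γ.kH h), Finset.sum_div, ← Finset.sum_add_distrib]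
    refine Finset.sum_nonpos fun v _ => ?_
    rcases eq_or_ne (u v) 0 with hv | hv
    · simp [toQ, hv]
    · have h4 : (0 : ℚ) ≤ toQ u v := by simpa [toQ] using hu v
      nlinarith [key v hv]
  rw [Γ.chi_cast h u, pair_add_right, Γ.pair_comm (toQ u) (Γ.kH h)] at h1
  have h5 : (Γ.chi h l : ℚ) ≤ Γ.chi h (l + u) := by linarith
  exact_mod_cast h5

/-- Since -(z,l) is the sum of the coordinates of l, a bound on it bounds each nonnegative
coordinate. The scale `B` is where the contraction starts: truncation at `B • z` leaves S_n fixed.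
-/
theorem exists_le_mul_of_mem_sublevel (h : Γ.discriminantGroup) {z : V → ℚ}
    (hz : ∀ v, Γ.pair z (toQ (E v)) = -1) (hz0 : ∀ v, 0 < z v) (n : ℤ) :
    ∃ B : ℝ, 0 ≤ B ∧ ∀ x ∈ Γ.sublevel h n, ∀ v, x v ≤ B * z v := by
  obtain ⟨B, hB⟩ := Γ.exists_abs_pair_le h z n
  refine ⟨∑ v, |(B : ℝ)| / z v, Finset.sum_nonneg fun v _ => by
    have : (0 : ℝ) < z v := by exact_mod_cast hz0 v
    positivity, fun x hx v => ?_⟩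
  obtain ⟨hx0, hx⟩ := (Γ.mem_sublevel_iff h n x).1 hx
  have h1 := hB (fun v => ⌈x v⌉) (hx _ fun v => Or.inr rfl)
  have h2 : Γ.pair z (toQ fun v => ⌈x v⌉) = -∑ v, (⌈x v⌉ : ℚ) := by
    rw [pair_eq_sum_E]; simp only [hz]; simp [toQ]
  rw [h2, abs_neg] at h1
  have h3 : (⌈x v⌉ : ℚ) ≤ ∑ v, (⌈x v⌉ : ℚ) :=
    Finset.single_le_sum (f := fun v => (⌈x v⌉ : ℚ))
      (fun w _ => by exact_mod_cast Int.ceil_nonneg (hx0 w)) (Finset.mem_univ v)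
  have h4 : (⌈x v⌉ : ℚ) ≤ |B| := h3.trans ((le_abs_self _).trans (h1.trans (le_abs_self B)))
  have h5 : (⌈x v⌉ : ℝ) ≤ |(B : ℝ)| := by exact_mod_cast h4
  have hzv : ∀ v, (0 : ℝ) < z v := fun v => by exact_mod_cast hz0 v
  have h6 := Finset.single_le_sum (f := fun v => |(B : ℝ)| / z v)
    (fun w _ => by have := hzv w; positivity) (Finset.mem_univ v)
  calc x v ≤ |(B : ℝ)| := (Int.le_ceil _).trans h5
    _ = |(B : ℝ)| / z v * z v := by have := hzv v; field_simp
    _ ≤ _ := mul_le_mul_of_nonneg_right h6 (hzv v).le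

theorem exists_contractibleSpace_sublevel (h : Γ.discriminantGroup) :
    ∃ n₀ : ℤ, ∀ n, n₀ ≤ n → ContractibleSpace (Γ.sublevel h n) := by
  obtain ⟨z, hz, hz0⟩ := Γ.exists_pair_E_eq_neg_one
  have hzr : ∀ v, (0 : ℝ) < z v := fun v => by exact_mod_cast hz0 v
  obtain ⟨T, hT⟩ := Γ.exists_chi_le_chi_add h hz
  -- Below scale `T` truncation may raise χ_h, but all roundings then lie in a fixed finite box, on
  -- which `n₀` bounds χ_h.
  obtain ⟨n₀, hn₀⟩ := ((Set.finite_Icc (0 : V → ℤ) fun v => ⌈|T| * z v⌉).image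
    (Γ.chi h)).bddAbove
  refine ⟨n₀, fun n hn => ?_⟩
  obtain ⟨B, hB0, hB⟩ := Γ.exists_le_mul_of_mem_sublevel h hz hz0 n
  have hmem : ∀ x ∈ Γ.sublevel h n, ∀ τ : ℝ, 0 ≤ τ →
      (fun v => min (x v) (τ * z v)) ∈ Γ.sublevel h n := by
    intro x hx τ hτ
    obtain ⟨hx0, hx⟩ := (Γ.mem_sublevel_iff h n x).1 hx
    have hmin0 : ∀ v, 0 ≤ min (x v) (τ * z v) := fun v =>
      le_min (hx0 v) (mul_nonneg hτ (hzr v).le)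
    refine (Γ.mem_sublevel_iff h n _).2 ⟨hmin0, fun l hl => ?_⟩
    have hfl : ∀ v, ⌊min (x v) (τ * z v)⌋ ≤ l v := fun v => by
      rcases hl v with h1 | h1
      · exact h1.ge
      · rw [h1]; exact Int.floor_le_ceil _
    have hce : ∀ v, l v ≤ ⌈min (x v) (τ * z v)⌉ := fun v => by
      rcases hl v with h1 | h1
      · rw [h1]; exact Int.floor_le_ceil _
      · exact h1.le
    rcases le_total T τ with hTτ | hTτ
    · let u : V → ℤ := fun v => if x v ≤ τ * z v then 0 else ⌈x v⌉ - l v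
      have h1 := hT τ hTτ l u (fun v => ?_) (fun v => ?_) (fun v hv => ?_)
      · refine h1.trans (hx _ fun v => ?_)
        by_cases hxv : x v ≤ τ * z v
        · have := hl v
          rw [min_eq_left hxv] at this
          simpa [u, hxv] using this
        · simp [u, hxv]
      · simp only [Pi.zero_apply, u]
        split_ifs
        · exact le_rfl
        · exact sub_nonneg.2 ((hce v).trans (Int.ceil_mono (min_le_left _ _)))
      · have h2 : (l v : ℝ) ≤ ⌈min (x v) (τ * z v)⌉ := by exact_mod_cast hce v
        have h3 := Int.ceil_lt_add_one (min (x v) (τ * z v))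
        have h4 := min_le_right (x v) (τ * z v)
        linarith
      · have hxv : ¬ x v ≤ τ * z v := fun hxv => hv (by simp [u, hxv])
        have h2 : (⌊min (x v) (τ * z v)⌋ : ℝ) ≤ l v := by exact_mod_cast hfl v
        rw [min_eq_right (not_le.1 hxv).le] at h2
        have h3 := Int.sub_one_lt_floor (τ * z v)
        linarith
    · refine (hn₀ ⟨l, ⟨fun v => ?_, fun v => ?_⟩, rfl⟩).trans hn
      · exact (Int.floor_nonneg.2 (hmin0 v)).trans (hfl v)
      · refine (hce v).trans (Int.ceil_mono ((min_le_right _ _).trans ?_))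
        exact mul_le_mul_of_nonneg_right (hTτ.trans (le_abs_self T)) (hzr v).le
  have h0 : (0 : V → ℝ) ∈ Γ.sublevel h n := by
    refine (Γ.mem_sublevel_iff h n _).2 ⟨le_rfl, fun l hl => ?_⟩
    have hl0 : l = 0 := by ext v; simpa using hl v
    refine (hn₀ ⟨l, ⟨hl0.ge, fun v => ?_⟩, rfl⟩).trans hn
    rw [hl0]
    exact Int.ceil_nonneg (mul_nonneg (abs_nonneg T) (hzr v).le)
  refine (contractible_iff_id_nullhomotopic _).2 ⟨⟨0, h0⟩, ⟨?_⟩⟩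
  exact
    { toFun := fun q => ⟨_, hmem q.2 q.2.2 ((1 - (q.1 : ℝ)) * B)
        (mul_nonneg (sub_nonneg.2 q.1.2.2) hB0)⟩
      continuous_toFun := by
        refine Continuous.subtype_mk (continuous_pi fun v => ?_) _
        exact ((continuous_apply v).comp (continuous_subtype_val.comp continuous_snd)).min
          (by fun_prop)
      map_zero_left := fun x => by
        ext v
        simpa using hB x x.2 v
      map_one_left := fun x => by
        have := ((Γ.mem_sublevel_iff h n x).1 x.2).1
        ext v
        simpa using this v }

end Geometry

/-! ### The minima min(d) and the terms E^∞ over contractible sublevel sets. -/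

theorem finrank_top_quotient_bot {R M : Type*} [Ring R] [AddCommGroup M] [Module R M]
    {F F' : Submodule R M} (hF : F = ⊤) (hF' : F' = ⊥) :
    Module.finrank R (F ⧸ F'.submoduleOf F) = Module.finrank R M := by
  subst hF hF'
  refine (LinearEquiv.finrank_eq ?_).trans (finrank_top R M)
  exact Submodule.quotEquivOfEqBot _ (by
    rw [Submodule.submoduleOf, Submodule.comap_bot, Submodule.ker_subtype])

section Minima

variable {V : Type} [Fintype V] [DecidableEq V] (Γ : ResolutionGraph V)

/-- Some (s, E_v) is a negative integer, so a multiple of E_v works. This makes the set in `minChi`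
nonempty, so that its `sInf` is a true minimum and not a default value. -/
theorem exists_nonneg_pair_le {s : V → ℚ} (hs : s ∈ Γ.lipmanCone) (hs0 : s ≠ 0) (d : ℕ) :
    ∃ l : V → ℤ, 0 ≤ l ∧ Γ.pair s (toQ l) ≤ -d := by
  obtain ⟨v, hv⟩ : ∃ v, Γ.pair s (toQ (E v)) ≠ 0 := by
    by_contra! h0
    have h1 := Γ.pair_self_neg hs0
    rw [pair_eq_sum_E] at h1
    simp only [h0] at h1
    simp at h1
  obtain ⟨k, hk⟩ := hs.1 (E v)
  have h1 := lt_of_le_of_ne (hs.2 v) hv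
  rw [hk] at h1
  have h2 : k ≤ -1 := by
    have : k < 0 := by exact_mod_cast h1
    omega
  refine ⟨d • E v, fun w => ?_, ?_⟩
  · simp only [E, Pi.zero_apply, Pi.smul_apply, Pi.single_apply]
    split_ifs <;> simp
  · rw [map_nsmul, ← Nat.cast_smul_eq_nsmul ℚ, pair_smul_right, hk]
    have h3 : (k : ℚ) ≤ -1 := by exact_mod_cast h2
    nlinarith [(Nat.cast_nonneg d : (0 : ℚ) ≤ d)]

theorem minChi_le_iff (h : Γ.discriminantGroup) {s : V → ℚ} (hs : s ∈ Γ.lipmanCone)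
    (hs0 : s ≠ 0) (d : ℕ) (n : ℤ) :
    Γ.minChi h s d ≤ n ↔ ∃ l : V → ℤ, 0 ≤ l ∧ Γ.pair s (toQ l) ≤ -d ∧ Γ.chi h l ≤ n := by
  have hbdd : BddBelow {n | ∃ l : V → ℤ, 0 ≤ l ∧ Γ.pair s (toQ l) ≤ -d ∧ Γ.chi h l = n} := by
    refine ⟨⌊Γ.pair (Γ.kH h) (Γ.kH h) / 8⌋, ?_⟩
    rintro _ ⟨l, -, -, rfl⟩
    exact Γ.chi_ge h l
  constructor
  · intro hn
    obtain ⟨l, hl0, hl⟩ := Γ.exists_nonneg_pair_le hs hs0 d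
    have hne : {n | ∃ l : V → ℤ, 0 ≤ l ∧ Γ.pair s (toQ l) ≤ -d ∧ Γ.chi h l = n}.Nonempty :=
      ⟨_, l, hl0, hl, rfl⟩
    obtain ⟨l', h0, h1, h2⟩ := Int.csInf_mem hne hbdd
    exact ⟨l', h0, h1, h2.trans_le hn⟩
  · rintro ⟨l, hl0, hl, hn⟩
    exact (csInf_le hbdd ⟨l, hl0, hl, rfl⟩).trans hn

theorem minChi_mono (h : Γ.discriminantGroup) {s : V → ℚ} (hs : s ∈ Γ.lipmanCone)
    (hs0 : s ≠ 0) : Monotone (Γ.minChi h s) := by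
  intro d d' hd
  obtain ⟨l, hl0, hl, hn⟩ := (Γ.minChi_le_iff h hs hs0 d' _).1 le_rfl
  have : (d : ℚ) ≤ d' := by exact_mod_cast hd
  exact (Γ.minChi_le_iff h hs hs0 d _).2 ⟨l, hl0, by linarith, hn⟩

theorem exists_lt_minChi (h : Γ.discriminantGroup) {s : V → ℚ} (hs : s ∈ Γ.lipmanCone)
    (hs0 : s ≠ 0) (n : ℤ) : ∃ d : ℕ, n < Γ.minChi h s d := by
  obtain ⟨B, hB⟩ := Γ.exists_abs_pair_le h s n
  obtain ⟨d, hd⟩ := exists_nat_gt B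
  refine ⟨d, ?_⟩
  by_contra! hn
  obtain ⟨l, -, hl, hln⟩ := (Γ.minChi_le_iff h hs hs0 d n).1 hn
  have h1 := neg_le_of_abs_le (hB l hln)
  linarith

theorem sublevel_inter_filtered_nonempty_iff_minChi_le (h : Γ.discriminantGroup) {s : V → ℚ}
    (hs : s ∈ Γ.lipmanCone) (hs0 : s ≠ 0) (n : ℤ) (d : ℕ) :
    (Γ.sublevel h n ∩ Γ.filtered s d).Nonempty ↔ Γ.minChi h s d ≤ n :=
  (Γ.sublevel_inter_filtered_nonempty_iff h hs n d).trans (Γ.minChi_le_iff h hs hs0 d n).symm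

theorem F_eq_bot (h : Γ.discriminantGroup) {s : V → ℚ} (hs : s ∈ Γ.lipmanCone)
    (hs0 : s ≠ 0) {n : ℤ} (b : ℕ) {d : ℕ} (hn : n < Γ.minChi h s d) : Γ.F h s n b d = ⊥ := by
  have hem : IsEmpty ↥(Γ.sublevel h n ∩ Γ.filtered s d) := by
    rw [Set.isEmpty_coe_sort, ← Set.not_nonempty_iff_eq_empty,
      Γ.sublevel_inter_filtered_nonempty_iff_minChi_le h hs hs0]
    exact not_le.2 hn
  have := subsingleton_homology_of_isEmpty b (Γ.sublevel h n ∩ Γ.filtered s d)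
  rw [F, LinearMap.range_eq_bot]
  exact LinearMap.ext fun x => by rw [Subsingleton.elim x 0, map_zero, map_zero]

theorem F_zero_eq_top (h : Γ.discriminantGroup) {s : V → ℚ} (hs : s ∈ Γ.lipmanCone)
    (hs0 : s ≠ 0) {n : ℤ} {d : ℕ} (hn : Γ.minChi h s d ≤ n)
    [ContractibleSpace (Γ.sublevel h n)] : Γ.F h s n 0 d = ⊤ :=
  LinearMap.range_eq_top.2 (homologyMap_zero_surjective _
    ((Γ.sublevel_inter_filtered_nonempty_iff_minChi_le h hs hs0 n d).2 hn))

theorem rankEInfty_eq_zero_of_lt_minChi (h : Γ.discriminantGroup) {s : V → ℚ}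
    (hs : s ∈ Γ.lipmanCone) (hs0 : s ≠ 0) {n : ℤ} (b : ℕ) {d : ℕ} (hn : n < Γ.minChi h s d) :
    Γ.rankEInfty h s n b d = 0 := by
  rw [rankEInfty, Γ.F_eq_bot h hs hs0 b hn]
  exact Module.finrank_zero_of_subsingleton

theorem coeffEInfty_eq_zero_of_lt_minChi (h : Γ.discriminantGroup) {s : V → ℚ}
    (hs : s ∈ Γ.lipmanCone) (hs0 : s ≠ 0) {n : ℤ} {d : ℕ} (hn : n < Γ.minChi h s d) :
    Γ.coeffEInfty h s d n = 0 :=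
  Finset.sum_eq_zero fun b _ => by
    rw [Γ.rankEInfty_eq_zero_of_lt_minChi h hs hs0 b hn]; simp

theorem rankEInfty_of_contractibleSpace (h : Γ.discriminantGroup) {s : V → ℚ}
    (hs : s ∈ Γ.lipmanCone) (hs0 : s ≠ 0) {n : ℤ} [ContractibleSpace (Γ.sublevel h n)]
    (b d : ℕ) : Γ.rankEInfty h s n b d =
      if b = 0 ∧ Γ.minChi h s d ≤ n ∧ n < Γ.minChi h s (d + 1) then 1 else 0 := by
  rcases eq_or_ne b 0 with rfl | hb
  · rcases le_or_gt (Γ.minChi h s d) n with h1 | h1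
    · rcases le_or_gt (Γ.minChi h s (d + 1)) n with h2 | h2
      · rw [if_neg (by omega), rankEInfty, Γ.F_zero_eq_top h hs hs0 h1, Γ.F_zero_eq_top h hs hs0 h2,
          Submodule.submoduleOf_self]
        exact Module.finrank_zero_of_subsingleton
      · rw [if_pos ⟨rfl, h1, h2⟩, ← finrank_homology_zero (Γ.sublevel h n)]
        -- The two sides reach the ℤ-module structure by different instances; it is unique on an
        -- abelian group.
        exact (congrArg (fun i => @Module.finrank ℤ _ _ _ i) (Subsingleton.elim _ _)).trans
          (finrank_top_quotient_bot (Γ.F_zero_eq_top h hs hs0 h1) (Γ.F_eq_bot h hs hs0 0 h2))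
    · rw [Γ.rankEInfty_eq_zero_of_lt_minChi h hs hs0 0 h1, if_neg (by omega)]
  · have := subsingleton_homology_of_contractibleSpace hb (Γ.sublevel h n)
    rw [if_neg (by tauto), rankEInfty]
    exact Module.finrank_zero_of_subsingleton

theorem coeffEInfty_of_contractibleSpace (h : Γ.discriminantGroup) {s : V → ℚ}
    (hs : s ∈ Γ.lipmanCone) (hs0 : s ≠ 0) {n : ℤ} [ContractibleSpace (Γ.sublevel h n)]
    (d : ℕ) : Γ.coeffEInfty h s d n =
      if Γ.minChi h s d ≤ n ∧ n < Γ.minChi h s (d + 1) then 1 else 0 := by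
  rw [coeffEInfty, Finset.sum_eq_single 0]
  · rw [Γ.rankEInfty_of_contractibleSpace h hs hs0]
    by_cases h1 : Γ.minChi h s d ≤ n ∧ n < Γ.minChi h s (d + 1) <;> simp [h1]
  · intro b _ hb
    rw [Γ.rankEInfty_of_contractibleSpace h hs hs0]
    simp [hb]
  · simp

end Minima

/-! ### Minimizers on slices and translation by s̃. -/

section Slices

variable {V : Type} [Fintype V] [DecidableEq V] (Γ : ResolutionGraph V)

/-- `l` minimizes `χ_h` on the slice `-(s, l) = c` of the lattice. -/
def IsSliceMin (h : Γ.discriminantGroup) (s : V → ℚ) (c : ℚ) (l : V → ℤ) : Prop :=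
  -Γ.pair s (toQ l) = c ∧ ∀ l' : V → ℤ, -Γ.pair s (toQ l') = c → Γ.chi h l ≤ Γ.chi h l'

theorem exists_isSliceMin (h : Γ.discriminantGroup) (s : V → ℚ) {c : ℚ}
    (hc : ∃ l : V → ℤ, -Γ.pair s (toQ l) = c) : ∃ l, Γ.IsSliceMin h s c l := by
  obtain ⟨l₀, hl₀⟩ := hc
  obtain ⟨_, ⟨l, hl, rfl⟩, hmin⟩ := Int.exists_least_of_bdd
    (P := fun n => ∃ l : V → ℤ, -Γ.pair s (toQ l) = c ∧ Γ.chi h l = n)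
    ⟨⌊Γ.pair (Γ.kH h) (Γ.kH h) / 8⌋, by rintro _ ⟨l, -, rfl⟩; exact Γ.chi_ge h l⟩
    ⟨_, l₀, hl₀, rfl⟩
  exact ⟨l, hl, fun l' hl' => hmin _ ⟨l', hl', rfl⟩⟩

variable {Γ} {h : Γ.discriminantGroup} {s : V → ℚ}

theorem IsSliceMin.chi_eq {c : ℚ} {l l' : V → ℤ} (hl : Γ.IsSliceMin h s c l)
    (hl' : Γ.IsSliceMin h s c l') : Γ.chi h l = Γ.chi h l' :=
  le_antisymm (hl.2 _ hl'.1) (hl'.2 _ hl.1)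

/-- The increment depends on l only through (s,l), hence is constant on each slice; so translation
by s̃ preserves minimizers. -/
theorem chi_add_smul {N : ℕ} {st : V → ℤ} (hst : toQ st = (N : ℚ) • s) (l : V → ℤ) :
    (Γ.chi h (l + st) : ℚ) = Γ.chi h l + Γ.chi h st + N * -Γ.pair s (toQ l) := by
  rw [chi_add, Γ.pair_comm (toQ l), hst, pair_smul_left]
  ring

theorem IsSliceMin.add {N : ℕ} {st : V → ℤ} (hst : toQ st = (N : ℚ) • s) {c : ℚ} {l : V → ℤ}
    (hl : Γ.IsSliceMin h s c l) : Γ.IsSliceMin h s (c + -Γ.pair s (toQ st)) (l + st) := by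
  refine ⟨by rw [map_add, pair_add_right, ← hl.1]; ring, fun l' hl' => ?_⟩
  have h1 : -Γ.pair s (toQ (l' - st)) = c := by
    rw [map_sub, sub_eq_add_neg, pair_add_right, pair_neg_right]; linarith
  have h2 := chi_add_smul (h := h) hst l
  have h3 := chi_add_smul (h := h) hst (l' - st)
  rw [sub_add_cancel, h1] at h3
  rw [hl.1] at h2
  have h4 : (Γ.chi h l : ℚ) ≤ Γ.chi h (l' - st) := by exact_mod_cast hl.2 _ h1
  have h5 : (Γ.chi h (l + st) : ℚ) ≤ Γ.chi h l' := by linarith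
  exact_mod_cast h5

theorem IsSliceMin.add_smul {N : ℕ} {st : V → ℤ} (hst : toQ st = (N : ℚ) • s) {c : ℚ}
    {l : V → ℤ} (hl : Γ.IsSliceMin h s c l) (m : ℕ) :
    Γ.IsSliceMin h s (c + m * -Γ.pair s (toQ st)) (l + m • st) := by
  induction m with
  | zero => simpa using hl
  | succ m ih =>
    have := ih.add hst
    rw [add_assoc l, ← succ_nsmul] at this
    convert this using 1
    push_cast; ring

end Slices

/-! ### Eventual behaviour of the slice minima and their agreement with min(d). -/

section Slices

variable {V : Type} [Fintype V] [DecidableEq V] (Γ : ResolutionGraph V)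
  (h : Γ.discriminantGroup) {s : V → ℚ} {N : ℕ} {st : V → ℤ} {e p : ℕ}

theorem natCast_mul_pos (hs0 : s ≠ 0) (hN : 0 < N) (hst : toQ st = (N : ℚ) • s)
    (hp : (e : ℚ) * p = -Γ.pair s (toQ st)) : 0 < p := by
  rw [hst, pair_smul_right] at hp
  have h1 := Γ.pair_self_neg hs0
  have h2 : (0 : ℚ) < N := by exact_mod_cast hN
  refine Nat.pos_of_ne_zero fun h0 => ?_
  rw [h0, Nat.cast_zero, mul_zero] at hp
  nlinarith

/-- The minima of `χ_h` on the slices `-(s, l) = e k` eventually do not decrease. -/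
theorem exists_forall_chi_le_of_isSliceMin (hs0 : s ≠ 0) (hN : 0 < N)
    (hst : toQ st = (N : ℚ) • s) (he : 0 < e)
    (heL : ∀ k : ℤ, ∃ l : V → ℤ, -Γ.pair s (toQ l) = (e : ℚ) * k)
    (hp : (e : ℚ) * p = -Γ.pair s (toQ st)) :
    ∃ K : ℕ, ∀ k k' : ℕ, K ≤ k → k ≤ k' → ∀ l l' : V → ℤ,
      Γ.IsSliceMin h s (e * k) l → Γ.IsSliceMin h s (e * k') l' → Γ.chi h l ≤ Γ.chi h l' := by
  have hp0 := Γ.natCast_mul_pos hs0 hN hst hp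
  choose a ha using fun k : ℕ => Γ.exists_isSliceMin h s (heL k)
  simp only [Int.cast_natCast] at ha
  have hrec : ∀ k, Γ.chi h (a (k + p)) = Γ.chi h (a k) + Γ.chi h st + N * (e * k) := by
    intro k
    have h1 := (ha k).add hst
    rw [← hp, ← mul_add, ← Nat.cast_add] at h1
    rw [(ha (k + p)).chi_eq h1]
    have h2 := chi_add_smul (h := h) hst (a k)
    rw [(ha k).1] at h2
    exact_mod_cast h2
  -- Each shift of k by p raises the increment between neighbouring slice minima by Ne > 0.
  have hdiff : ∀ r m, Γ.chi h (a (r + m * p + 1)) - Γ.chi h (a (r + m * p)) =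
      Γ.chi h (a (r + 1)) - Γ.chi h (a r) + m * (N * e) := by
    intro r m
    induction m with
    | zero => simp
    | succ m ih =>
      have h1 := hrec (r + m * p + 1)
      have h2 := hrec (r + m * p)
      rw [show r + (m + 1) * p + 1 = r + m * p + 1 + p by ring,
        show r + (m + 1) * p = r + m * p + p by ring, h1, h2]
      push_cast
      linear_combination ih
  -- `M` bounds the size of the first p increments, so after `M` shifts by p every increment is
  -- nonnegative.
  set M : ℕ := ∑ r ∈ Finset.range p, (Γ.chi h (a (r + 1)) - Γ.chi h (a r)).natAbs with hM
  have hstep : ∀ k, M * p ≤ k → Γ.chi h (a k) ≤ Γ.chi h (a (k + 1)) := by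
    intro k hk
    have h1 := hdiff (k % p) (k / p)
    rw [show k % p + k / p * p = k by rw [mul_comm]; exact Nat.mod_add_div k p] at h1
    have h2 : M ≤ k / p := (Nat.le_div_iff_mul_le hp0).2 hk
    have h3 : (Γ.chi h (a (k % p + 1)) - Γ.chi h (a (k % p))).natAbs ≤ M :=
      Finset.single_le_sum (f := fun r => (Γ.chi h (a (r + 1)) - Γ.chi h (a r)).natAbs)
        (fun _ _ => Nat.zero_le _) (Finset.mem_range.2 (Nat.mod_lt k hp0))
    have h4 : k / p ≤ k / p * (N * e) := Nat.le_mul_of_pos_right _ (Nat.mul_pos hN he)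
    have h5 : ((k / p : ℕ) : ℤ) ≤ (k / p : ℕ) * (N * e) := by exact_mod_cast h4
    omega
  refine ⟨M * p, fun k k' hk hkk' l l' hl hl' => ?_⟩
  rw [hl.chi_eq (ha k), hl'.chi_eq (ha k')]
  induction k', hkk' using Nat.le_induction generalizing l' with
  | base => exact le_rfl
  | succ j hj ih => exact (ih (a j) (ha j)).trans (hstep j (hk.trans hj))

/-- Far out, the slices have minimizers in the first quadrant. -/
theorem exists_forall_nonneg_isSliceMin (hs : s ∈ Γ.lipmanCone) (hs0 : s ≠ 0) (hN : 0 < N)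
    (hst : toQ st = (N : ℚ) • s)
    (heL : ∀ k : ℤ, ∃ l : V → ℤ, -Γ.pair s (toQ l) = (e : ℚ) * k)
    (hp : (e : ℚ) * p = -Γ.pair s (toQ st)) :
    ∃ K : ℕ, ∀ k : ℕ, K ≤ k → ∃ l : V → ℤ, 0 ≤ l ∧ Γ.IsSliceMin h s (e * k) l := by
  have hp0 := Γ.natCast_mul_pos hs0 hN hst hp
  have hst0 : ∀ v, 0 < st v := by
    intro v
    have h1 : (st v : ℚ) = N * s v := congrFun hst v
    have h2 : (0 : ℚ) < N := by exact_mod_cast hN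
    have h3 := mul_pos h2 (Γ.pos_of_mem_lipmanCone hs hs0 v)
    rw [← h1] at h3
    exact_mod_cast h3
  choose a ha using fun k : ℕ => Γ.exists_isSliceMin h s (heL k)
  simp only [Int.cast_natCast] at ha
  -- `M` bounds all coordinates of the first p minimizers; every coordinate of s̃ is at least 1, so
  -- adding `M` or more copies of s̃ gives a nonnegative point.
  set M : ℕ := ∑ r ∈ Finset.range p, ∑ v, (a r v).natAbs with hM
  refine ⟨M * p, fun k hk => ⟨a (k % p) + (k / p) • st, fun v => ?_, ?_⟩⟩
  · have h2 : M ≤ k / p := (Nat.le_div_iff_mul_le hp0).2 hk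
    have h3 : ∑ v, (a (k % p) v).natAbs ≤ M :=
      Finset.single_le_sum (f := fun r => ∑ v, (a r v).natAbs)
        (fun _ _ => Nat.zero_le _) (Finset.mem_range.2 (Nat.mod_lt k hp0))
    have h4 : (a (k % p) v).natAbs ≤ ∑ v, (a (k % p) v).natAbs :=
      Finset.single_le_sum (f := fun v => (a (k % p) v).natAbs)
        (fun _ _ => Nat.zero_le _) (Finset.mem_univ v)
    have h5 : ((k / p : ℕ) : ℤ) ≤ (k / p : ℕ) * st v :=
      le_mul_of_one_le_right (Int.natCast_nonneg _) (hst0 v)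
    rw [← nsmul_eq_mul (k / p)] at h5
    simp only [Pi.zero_apply, Pi.add_apply, Pi.smul_apply]
    omega
  · have h1 := (ha (k % p)).add_smul hst (k / p)
    convert h1 using 1
    rw [← hp]
    have h2 : ((k % p + p * (k / p) : ℕ) : ℚ) = k := by rw [Nat.mod_add_div]
    rw [← h2]
    push_cast; ring

/-- The half-space -(s,l) ≥ ek is the union of the slices ej with j ≥ k. Their minima do not
decrease, so the slice ek wins, and a nonnegative minimizer on it meets the constraint l ≥ 0. -/
theorem exists_forall_chi_eq_minChi (hs : s ∈ Γ.lipmanCone) (hs0 : s ≠ 0) (hN : 0 < N)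
    (hst : toQ st = (N : ℚ) • s) (he : 0 < e)
    (heL : (Set.range fun l : V → ℤ => -Γ.pair s (toQ l)) =
      Set.range fun k : ℤ => (e : ℚ) * (k : ℚ))
    (hp : (e : ℚ) * p = -Γ.pair s (toQ st)) :
    ∃ K : ℕ, ∀ k : ℕ, K ≤ k → (∃ l, Γ.IsSliceMin h s (e * k) l) ∧
      ∀ l, Γ.IsSliceMin h s (e * k) l → Γ.chi h l = Γ.minChi h s (e * k) := by
  have heL' : ∀ k : ℤ, ∃ l : V → ℤ, -Γ.pair s (toQ l) = (e : ℚ) * k := fun k =>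
    heL.ge ⟨k, rfl⟩
  have he' : (0 : ℚ) < e := by exact_mod_cast he
  obtain ⟨K₁, hK₁⟩ := Γ.exists_forall_chi_le_of_isSliceMin h hs0 hN hst he heL' hp
  obtain ⟨K₂, hK₂⟩ := Γ.exists_forall_nonneg_isSliceMin h hs hs0 hN hst heL' hp
  refine ⟨max K₁ K₂, fun k hk => ?_⟩
  obtain ⟨l₀, hl₀, hmin⟩ := hK₂ k ((le_max_right _ _).trans hk)
  refine ⟨⟨l₀, hmin⟩, fun l hl => ?_⟩
  rw [hl.chi_eq hmin]
  refine le_antisymm ?_ ((Γ.minChi_le_iff h hs hs0 _ _).2 ⟨l₀, hl₀, ?_, le_rfl⟩)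
  · obtain ⟨l', -, hl', hn⟩ := (Γ.minChi_le_iff h hs hs0 (e * k) _).1 le_rfl
    obtain ⟨j, hj⟩ := heL.le ⟨l', rfl⟩
    simp only at hj
    have hkj : (k : ℤ) ≤ j := by
      have h1 : (e : ℚ) * k ≤ e * j := by
        rw [hj]; push_cast at hl'; linarith
      exact_mod_cast le_of_mul_le_mul_left h1 he'
    lift j to ℕ using (Int.natCast_nonneg k).trans hkj
    obtain ⟨l'', hl''⟩ := Γ.exists_isSliceMin h s (heL' j)
    rw [Int.cast_natCast] at hl''
    refine (hK₁ k j ((le_max_left _ _).trans hk) (by exact_mod_cast hkj) _ _ hmin hl'').trans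
      ((hl''.2 l' ?_).trans hn)
    rw [← hj, Int.cast_natCast]
  · have := hmin.1
    push_cast; linarith

theorem minChi_congr {d d' : ℕ}
    (heL : (Set.range fun l : V → ℤ => -Γ.pair s (toQ l)) =
      Set.range fun k : ℤ => (e : ℚ) * (k : ℚ))
    (hd : ∀ k : ℤ, (d : ℤ) ≤ e * k ↔ (d' : ℤ) ≤ e * k) : Γ.minChi h s d = Γ.minChi h s d' := by
  have key : ∀ l : V → ℤ, Γ.pair s (toQ l) ≤ -d ↔ Γ.pair s (toQ l) ≤ -d' := by
    intro l
    obtain ⟨k, hk⟩ := heL.le ⟨l, rfl⟩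
    simp only at hk
    have hk' : Γ.pair s (toQ l) = -(e * k) := by rw [hk, neg_neg]
    rw [hk', neg_le_neg_iff, neg_le_neg_iff]
    exact_mod_cast hd k
  simp only [minChi, key]

theorem minChi_eq_succ {d : ℕ}
    (heL : (Set.range fun l : V → ℤ => -Γ.pair s (toQ l)) =
      Set.range fun k : ℤ => (e : ℚ) * (k : ℚ)) (hd : ¬ e ∣ d) :
    Γ.minChi h s d = Γ.minChi h s (d + 1) := by
  refine Γ.minChi_congr h heL fun k => ⟨fun hk => ?_, fun hk => ?_⟩
  · push_cast
    refine Int.add_one_le_of_lt (lt_of_le_of_ne hk fun h0 => hd ?_)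
    exact Int.natCast_dvd_natCast.1 ⟨k, h0⟩
  · push_cast at hk; omega

theorem minChi_mul_add_one (he : 0 < e) (c : ℕ)
    (heL : (Set.range fun l : V → ℤ => -Γ.pair s (toQ l)) =
      Set.range fun k : ℤ => (e : ℚ) * (k : ℚ)) :
    Γ.minChi h s (e * c + 1) = Γ.minChi h s (e * (c + 1)) := by
  have he' : (0 : ℤ) < e := by exact_mod_cast he
  refine Γ.minChi_congr h heL fun k => ⟨fun hk => ?_, fun hk => ?_⟩
  · push_cast at hk ⊢
    have h1 : (c : ℤ) < k := lt_of_mul_lt_mul_left (Int.lt_of_add_one_le hk) he'.le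
    exact mul_le_mul_of_nonneg_left h1 he'.le
  · push_cast at hk ⊢
    nlinarith

end Slices

/-! ### Coefficients of the theta-like series and the telescoping sum. -/

section Series

theorem coeff_geomQ (n : ℤ) : geomQ.coeff n = if 0 ≤ n then 1 else 0 := by
  split_ifs with hn
  · lift n to ℕ using hn
    rw [geomQ, HahnSeries.ofPowerSeries_apply_coeff, PowerSeries.coeff_mk]
  · rw [geomQ, HahnSeries.ofPowerSeries_apply]
    refine HahnSeries.embDomain_of_notMem_range ?_
    rintro ⟨k, hk⟩
    exact hn (hk ▸ Int.natCast_nonneg k)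

theorem coeff_geomQ_mul_Q (a n : ℤ) :
    (geomQ * Q a).coeff n = if a ≤ n then 1 else 0 := by
  rw [Q, HahnSeries.coeff_mul_single, mul_one, coeff_geomQ]
  simp

theorem Q_mul_Q (a b : ℤ) : Q a * Q b = Q (a + b) := by
  simp [Q, HahnSeries.single_mul_single]

variable {V : Type} [Fintype V] [DecidableEq V] (Γ : ResolutionGraph V)
  (h : Γ.discriminantGroup)

theorem coeff_mul_thetaSeries (st l : V → ℤ) {e p : ℕ} (he : 0 < e) (q : Fin p) (j : ℕ) :
    PowerSeries.coeff j (PowerSeries.X ^ (e * (q : ℕ)) * PowerSeries.C (Q (Γ.chi h l)) *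
        Γ.thetaSeries h st l (e * p)) =
      if e ∣ j ∧ j / e % p = q then Q (Γ.chi h (l + (j / e / p) • st)) else 0 := by
  have hp : 0 < p := q.pos
  rw [mul_assoc, PowerSeries.coeff_X_pow_mul', PowerSeries.coeff_C_mul, thetaSeries,
    PowerSeries.coeff_mk]
  by_cases hj : e ∣ j ∧ j / e % p = q
  · obtain ⟨⟨i, rfl⟩, hi⟩ := hj
    rw [Nat.mul_div_cancel_left i he] at hi
    have h1 : (q : ℕ) + p * (i / p) = i := by rw [← hi]; exact Nat.mod_add_div i p
    have h2 : e * i - e * q = e * p * (i / p) := by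
      conv_lhs => rw [← h1]
      rw [mul_add, Nat.add_sub_cancel_left, mul_assoc]
    rw [if_pos (Nat.mul_le_mul_left e (by omega)), Nat.mul_div_cancel_left i he,
      if_pos ⟨Dvd.intro _ rfl, hi⟩, h2, Finset.sum_eq_single (i / p)]
    · rw [if_pos rfl, Q_mul_Q]
      congr 1; ring
    · intro m _ hm
      exact if_neg fun h3 => hm (Nat.eq_of_mul_eq_mul_left (Nat.mul_pos he hp) h3)
    · intro hn
      refine absurd (Finset.mem_range.2 (Nat.lt_succ_of_le ?_)) hn
      exact Nat.le_mul_of_pos_left _ (Nat.mul_pos he hp)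
  · rw [if_neg hj]
    split_ifs with hle
    · rw [Finset.sum_eq_zero, mul_zero]
      intro m _
      refine if_neg fun h3 => hj ?_
      have h4 : j = e * (q + p * m) := by
        rw [mul_add, ← mul_assoc, h3]; omega
      refine ⟨⟨_, h4⟩, ?_⟩
      rw [h4, Nat.mul_div_cancel_left _ he, Nat.add_mul_mod_self_left, Nat.mod_eq_of_lt q.2]
    · rfl

/-- The q-th summand occupies the exponents e(q + mp); by division with remainder the p summands
fill the multiples of e exactly once. -/
theorem coeff_sum_thetaSeries (st : V → ℤ) {e p : ℕ} (he : 0 < e) (hp : 0 < p)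
    (l : Fin p → V → ℤ) (μ : ℕ → ℤ)
    (hl : ∀ (q : Fin p) (m : ℕ), Γ.chi h (l q + m • st) = μ (q + m * p)) (j : ℕ) :
    PowerSeries.coeff j (∑ q : Fin p, PowerSeries.X ^ (e * (q : ℕ)) *
        PowerSeries.C (Q (Γ.chi h (l q))) * Γ.thetaSeries h st (l q) (e * p)) =
      if e ∣ j then Q (μ (j / e)) else 0 := by
  simp only [map_sum, Γ.coeff_mul_thetaSeries h st _ he, hl]
  by_cases hj : e ∣ j
  · rw [Finset.sum_eq_single ⟨j / e % p, Nat.mod_lt _ hp⟩]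
    · rw [if_pos ⟨hj, rfl⟩, if_pos hj]
      congr 2
      rw [mul_comm]; exact Nat.mod_add_div _ _
    · intro q _ hq
      exact if_neg fun h1 => hq (Fin.ext h1.2.symm)
    · simp
  · simp [hj]

/-- The coefficients of `T^d₀ (Q^{μ(d₀)} + (T^e - 1) S) / (1 - Q)`, where `S` collects the terms
`T^{ei} Q^{ν(i)}`, are the differences of consecutive values of `Q^μ / (1 - Q)`. -/
theorem coeff_telescope {e : ℕ} (he : 0 < e) (c : ℕ) (μ : ℕ → ℤ)
    (hμ : ∀ d, ¬ e ∣ d → μ d = μ (d + 1)) (hμ' : ∀ c, μ (e * c + 1) = μ (e * (c + 1)))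
    (S : PowerSeries QSeries)
    (hS : ∀ j, PowerSeries.coeff j S = if e ∣ j then Q (μ (e * (c + 1 + j / e))) else 0) (d : ℕ) :
    PowerSeries.coeff d (PowerSeries.X ^ (e * c) * PowerSeries.C geomQ *
        (PowerSeries.C (Q (μ (e * c))) + (PowerSeries.X ^ e - 1) * S)) =
      if e * c ≤ d then geomQ * Q (μ d) - geomQ * Q (μ (d + 1)) else 0 := by
  rw [mul_assoc, PowerSeries.coeff_X_pow_mul']
  by_cases hd : e * c ≤ d
  · obtain ⟨j, rfl⟩ := Nat.exists_eq_add_of_le hd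
    rw [if_pos hd, if_pos hd, Nat.add_sub_cancel_left, ← mul_sub]
    rw [PowerSeries.coeff_C_mul, map_add, sub_mul, one_mul, map_sub, PowerSeries.coeff_X_pow_mul',
      PowerSeries.coeff_C]
    congr 1
    by_cases hj : e ∣ j
    · obtain ⟨i, rfl⟩ := hj
      have h1 : μ (e * c + e * i + 1) = μ (e * (c + 1 + i)) := by
        rw [← mul_add, hμ', add_right_comm]
      rw [h1, hS (e * i), if_pos (Dvd.intro _ rfl), Nat.mul_div_cancel_left i he]
      -- At i = 0 the term Q^{μ(ec)} stands in for the missing shifted term; for i > 0 the factor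
      -- T^e supplies the previous term of S.
      cases i with
      | zero => simp [he.ne', sub_eq_add_neg]
      | succ i =>
        have h2 : e * (i + 1) - e = e * i := by rw [mul_add, mul_one, Nat.add_sub_cancel]
        rw [if_neg (Nat.mul_pos he i.succ_pos).ne', if_pos (Nat.le_mul_of_pos_right _ i.succ_pos),
          h2, hS, if_pos (Dvd.intro _ rfl), Nat.mul_div_cancel_left i he, zero_add, ← mul_add,
          add_assoc c 1 i, add_comm 1 i]
    · have h1 : ¬ e ∣ e * c + j := fun h0 => hj ((Nat.dvd_add_right (Dvd.intro _ rfl)).1 h0)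
      rw [← hμ _ h1, sub_self, hS j, if_neg hj, sub_zero,
        if_neg (by rintro rfl; exact hj (dvd_zero e)), zero_add]
      split_ifs with hle
      · rw [hS, if_neg fun h0 => hj ((Nat.dvd_sub_iff_left hle dvd_rfl).1 h0)]
      · rfl
  · rw [if_neg hd, if_neg hd]

end Series

/-! ### Coefficients and finiteness properties of PE_∞. -/

section PoincareSeries

variable {V : Type} [Fintype V] [DecidableEq V] (Γ : ResolutionGraph V)
  (h : Γ.discriminantGroup) {s : V → ℚ}

theorem coeff_coeff_PEInfty (d : ℕ) (n : ℤ) :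
    (PowerSeries.coeff d (Γ.PEInfty h s)).coeff n = Γ.coeffEInfty h s d n := by
  simp [PEInfty]

theorem coeff_PEInftyOne (n : ℤ) :
    (Γ.PEInftyOne h s).coeff n = ∑ᶠ d, Γ.coeffEInfty h s d n := by
  simp [PEInftyOne]

theorem coeffEInfty_eq_zero_of_lt_floor {d : ℕ} {n : ℤ}
    (hn : n < ⌊Γ.pair (Γ.kH h) (Γ.kH h) / 8⌋) : Γ.coeffEInfty h s d n = 0 :=
  Finset.sum_eq_zero fun b _ => by rw [Γ.rankEInfty_eq_zero h s b d hn]; simp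

theorem coeff_PEInfty_of_le_minChi (hs : s ∈ Γ.lipmanCone) (hs0 : s ≠ 0) {n₀ : ℤ}
    (hn₀ : ∀ n, n₀ ≤ n → ContractibleSpace (Γ.sublevel h n)) {d : ℕ}
    (hd : n₀ ≤ Γ.minChi h s d) :
    PowerSeries.coeff d (Γ.PEInfty h s) =
      geomQ * Q (Γ.minChi h s d) - geomQ * Q (Γ.minChi h s (d + 1)) := by
  ext1
  funext n
  rw [HahnSeries.coeff_sub, coeff_geomQ_mul_Q, coeff_geomQ_mul_Q, coeff_coeff_PEInfty]
  have hmono := Γ.minChi_mono h hs hs0 (Nat.le_add_right d 1)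
  rcases lt_or_ge n (Γ.minChi h s d) with hn | hn
  · rw [Γ.coeffEInfty_eq_zero_of_lt_minChi h hs hs0 hn, if_neg (by omega), if_neg (by omega),
      sub_zero]
  · have := hn₀ n (hd.trans hn)
    rw [Γ.coeffEInfty_of_contractibleSpace h hs hs0]
    rcases lt_or_ge n (Γ.minChi h s (d + 1)) with hn' | hn'
    · rw [if_pos ⟨hn, hn'⟩, if_pos hn, if_neg (by omega), sub_zero]
    · rw [if_neg (by omega), if_pos hn, if_pos hn', sub_self]

/-- For d < d₀ and large n ≥ min(d₀) one has min(d+1) ≤ n, so the coefficient vanishes; for very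
negative n the space S_n is empty. -/
theorem finite_coeffEInfty_ne_zero_lt (hs : s ∈ Γ.lipmanCone) (hs0 : s ≠ 0) (d₀ : ℕ) :
    {dn : ℕ × ℤ | dn.1 < d₀ ∧ Γ.coeffEInfty h s dn.1 dn.2 ≠ 0}.Finite := by
  obtain ⟨n₀, hn₀⟩ := Γ.exists_contractibleSpace_sublevel h
  refine ((Set.finite_Iio d₀).prod (Set.finite_Icc ⌊Γ.pair (Γ.kH h) (Γ.kH h) / 8⌋
    (max n₀ (Γ.minChi h s d₀)))).subset ?_
  rintro ⟨d, n⟩ ⟨hd, hne⟩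
  refine ⟨hd, ?_, ?_⟩
  · by_contra! hn
    exact hne (Γ.coeffEInfty_eq_zero_of_lt_floor h hn)
  · by_contra! hn
    have := hn₀ n ((le_max_left _ _).trans hn.le)
    refine hne ?_
    rw [Γ.coeffEInfty_of_contractibleSpace h hs hs0, if_neg]
    exact fun h1 => h1.2.not_ge ((Γ.minChi_mono h hs hs0 (Nat.succ_le_of_lt hd)).trans
      ((le_max_right _ _).trans hn.le))

theorem finite_coeff_PEInfty_ne_zero (hs : s ∈ Γ.lipmanCone) (hs0 : s ≠ 0) (n : ℤ) :
    {d : ℕ | (PowerSeries.coeff d (Γ.PEInfty h s)).coeff n ≠ 0}.Finite := by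
  obtain ⟨d₁, hd₁⟩ := Γ.exists_lt_minChi h hs hs0 n
  refine (Set.finite_Iio d₁).subset fun d hd => ?_
  by_contra hle
  refine hd ?_
  rw [coeff_coeff_PEInfty]
  exact Γ.coeffEInfty_eq_zero_of_lt_minChi h hs hs0
    (hd₁.trans_le (Γ.minChi_mono h hs hs0 (not_lt.1 hle)))

theorem finsum_coeffEInfty (hs : s ∈ Γ.lipmanCone) (hs0 : s ≠ 0) {n : ℤ}
    [ContractibleSpace (Γ.sublevel h n)] (hn : Γ.minChi h s 0 ≤ n) :
    ∑ᶠ d, Γ.coeffEInfty h s d n = 1 := by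
  have hmono := Γ.minChi_mono h hs hs0
  obtain ⟨d, hd, hd'⟩ : ∃ d, Γ.minChi h s d ≤ n ∧ n < Γ.minChi h s (d + 1) := by
    by_contra! hstep
    obtain ⟨d₁, hd₁⟩ := Γ.exists_lt_minChi h hs hs0 n
    exact hd₁.not_ge (Nat.rec hn (fun d => hstep d) d₁)
  rw [finsum_eq_single _ d]
  · rw [Γ.coeffEInfty_of_contractibleSpace h hs hs0, if_pos ⟨hd, hd'⟩]
  · intro j hj
    rw [Γ.coeffEInfty_of_contractibleSpace h hs hs0, if_neg]
    rintro ⟨h1, h2⟩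
    rcases lt_or_gt_of_ne hj with hlt | hlt
    · exact h2.not_ge ((hmono (Nat.succ_le_of_lt hlt)).trans hd)
    · exact hd'.not_ge ((hmono (Nat.succ_le_of_lt hlt)).trans h1)

theorem finite_coeff_PEInftyOne_sub_geomQ_ne_zero (hs : s ∈ Γ.lipmanCone) (hs0 : s ≠ 0) :
    {n : ℤ | (Γ.PEInftyOne h s - geomQ).coeff n ≠ 0}.Finite := by
  obtain ⟨n₀, hn₀⟩ := Γ.exists_contractibleSpace_sublevel h
  refine (Set.finite_Icc (min 0 ⌊Γ.pair (Γ.kH h) (Γ.kH h) / 8⌋)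
    (max 0 (max n₀ (Γ.minChi h s 0)))).subset fun n hne => ⟨?_, ?_⟩
  · by_contra! hn
    obtain ⟨h1, h2⟩ := lt_min_iff.1 hn
    refine hne ?_
    rw [HahnSeries.coeff_sub, coeff_PEInftyOne, coeff_geomQ, if_neg (not_le.2 h1), sub_zero]
    exact finsum_eq_zero_of_forall_eq_zero fun d => Γ.coeffEInfty_eq_zero_of_lt_floor h h2
  · by_contra! hn
    obtain ⟨h1, h2⟩ := max_lt_iff.1 hn
    obtain ⟨h2, h3⟩ := max_lt_iff.1 h2
    have := hn₀ n h2.le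
    refine hne ?_
    rw [HahnSeries.coeff_sub, coeff_PEInftyOne, coeff_geomQ, if_pos h1.le,
      Γ.finsum_coeffEInfty h hs hs0 h3.le, sub_self]

theorem chi_add_sub_chi (l t : V → ℤ) :
    ((Γ.chi h (l + t) - Γ.chi h l : ℤ) : ℚ) =
      -Γ.pair (toQ t) (toQ t - Γ.ZK + (2 : ℚ) • Γ.sH h + (2 : ℚ) • toQ l) / 2 := by
  rw [Int.cast_sub, chi_add, Γ.chi_cast h t, kH, sub_eq_add_neg (toQ t)]
  simp only [pair_add_right, pair_smul_right, Γ.pair_comm (toQ l) (toQ t)]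
  ring

end PoincareSeries

end ResolutionGraph

/-! ### The main theorem. -/

open ResolutionGraph in
theorem mainTheorem2 {V : Type} [Fintype V] [DecidableEq V] (Γ : ResolutionGraph V)
    (h : Γ.discriminantGroup) (s : V → ℚ) (hs : s ∈ Γ.lipmanCone) (hs0 : s ≠ 0)
    (N : ℕ) (hN : IsLeast {k : ℕ | 0 < k ∧ (k : ℚ) • s ∈ lattice (V := V)} N)
    (st : V → ℤ) (hst : toQ st = (N : ℚ) • s)
    (e : ℕ) (he : 0 < e)
    (heL : (Set.range fun l : V → ℤ => -Γ.pair s (toQ l)) =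
      Set.range fun k : ℤ => (e : ℚ) * (k : ℚ))
    (p : ℕ) (hp : (e : ℚ) * (p : ℚ) = -Γ.pair s (toQ st)) :
    (∃ K : ℕ, ∀ k₀ : ℕ, K ≤ k₀ → ∀ d₀ : ℕ, d₀ = e * (k₀ * p - 1) →
      ∃ l : Fin p → (V → ℤ),
        (∃ D : PowerSeries QSeries,
          Γ.PEInfty h s =
            PowerSeries.X ^ d₀ * PowerSeries.C geomQ *
              (PowerSeries.C (Q (Γ.minChi h s d₀)) +
                (PowerSeries.X ^ e - 1) * ∑ q : Fin p,
                  PowerSeries.X ^ (e * (q : ℕ)) * PowerSeries.C (Q (Γ.chi h (l q))) *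
                    Γ.thetaSeries h st (l q) (e * p)) + D ∧
          {dn : ℕ × ℤ | (PowerSeries.coeff dn.1 D).coeff dn.2 ≠ 0}.Finite ∧
          ∀ d, d₀ ≤ d → PowerSeries.coeff d D = 0) ∧
        ∀ (q : Fin p) (m : ℕ),
          ((e * m * p : ℕ) : ℚ) = -Γ.pair s (toQ (m • st)) ∧
          ((Γ.chi h (l q + m • st) - Γ.chi h (l q) : ℤ) : ℚ) =
            -Γ.pair (toQ (m • st))
              (toQ (m • st) - Γ.ZK + (2 : ℚ) • Γ.sH h + (2 : ℚ) • toQ (l q)) / 2) ∧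
    (∀ n : ℤ, {d : ℕ | (PowerSeries.coeff d (Γ.PEInfty h s)).coeff n ≠ 0}.Finite) ∧
    {n : ℤ | (Γ.PEInftyOne h s - geomQ).coeff n ≠ 0}.Finite := by
  refine ⟨?_, Γ.finite_coeff_PEInfty_ne_zero h hs hs0,
    Γ.finite_coeff_PEInftyOne_sub_geomQ_ne_zero h hs hs0⟩
  have hp0 := Γ.natCast_mul_pos hs0 hN.1.1 hst hp
  obtain ⟨n₀, hn₀⟩ := Γ.exists_contractibleSpace_sublevel h
  obtain ⟨d₁, hd₁⟩ := Γ.exists_lt_minChi h hs hs0 n₀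
  obtain ⟨K, hK⟩ := Γ.exists_forall_chi_eq_minChi h hs hs0 hN.1.1 hst he heL hp
  -- The `+ 1` absorbs the one in k₀p - 1: it makes the truncated subtraction genuine and gives d₀ ≥
  -- d₁.
  refine ⟨max K (d₁ + 1), ?_⟩
  rintro k₀ hk₀ _ rfl
  have hk₀K : K ≤ k₀ * p :=
    ((le_max_left _ _).trans hk₀).trans (Nat.le_mul_of_pos_right _ hp0)
  have hk₀d : d₁ + 1 ≤ k₀ * p :=
    ((le_max_right _ _).trans hk₀).trans (Nat.le_mul_of_pos_right _ hp0)
  obtain ⟨c, hc⟩ : ∃ c, k₀ * p = c + 1 := ⟨k₀ * p - 1, by omega⟩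
  rw [hc] at hk₀K hk₀d
  rw [hc, Nat.add_sub_cancel]
  have hd₁c : d₁ ≤ e * c := (Nat.le_of_succ_le_succ hk₀d).trans (Nat.le_mul_of_pos_left c he)
  -- l_q minimizes χ_h on the slice e(k₀p + q), since c + 1 = k₀p.
  choose l hl using fun q : Fin p => (hK (c + 1 + q) (by omega)).1
  have hlχ : ∀ (q : Fin p) (m : ℕ), Γ.chi h (l q + m • st) =
      Γ.minChi h s (e * (c + 1 + (q + m * p))) := by
    intro q m
    refine (hK _ (by omega)).2 _ ?_
    convert (hl q).add_smul hst m using 1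
    rw [← hp]
    push_cast; ring
  have hmain := coeff_telescope he c (Γ.minChi h s) (fun d => Γ.minChi_eq_succ h heL)
    (fun c => Γ.minChi_mul_add_one h he c heL) _
    (Γ.coeff_sum_thetaSeries h st he hp0 l (fun i => Γ.minChi h s (e * (c + 1 + i))) hlχ)
  -- D is by definition the difference of the two series; the content is that it vanishes from
  -- T^{d₀} on and has finite support.
  refine ⟨l, ⟨_, (add_sub_cancel _ _).symm, ?_, fun d hd => ?_⟩, fun q m => ⟨?_, ?_⟩⟩
  · refine (Γ.finite_coeffEInfty_ne_zero_lt h hs hs0 (e * c)).subset ?_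
    rintro ⟨d, n⟩ hne
    have hd : d < e * c := by
      by_contra! hd
      refine hne ?_
      rw [map_sub, hmain, if_pos hd, Γ.coeff_PEInfty_of_le_minChi h hs hs0 hn₀
        (hd₁.le.trans (Γ.minChi_mono h hs hs0 (hd₁c.trans hd))), sub_self, HahnSeries.coeff_zero]
    refine ⟨hd, fun h0 => hne ?_⟩
    rw [map_sub, hmain, if_neg (not_le.2 hd), sub_zero, coeff_coeff_PEInfty, h0]
  · rw [map_sub, hmain, if_pos hd, Γ.coeff_PEInfty_of_le_minChi h hs hs0 hn₀
      (hd₁.le.trans (Γ.minChi_mono h hs hs0 (hd₁c.trans hd))), sub_self]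
  · rw [map_nsmul, ← Nat.cast_smul_eq_nsmul ℚ, pair_smul_right, ← mul_neg, ← hp]
    push_cast; ring
  · exact Γ.chi_add_sub_chi h (l q) (m • st)
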